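/- **Proposition 1.2.** Let $\theta>0$. Let $Y_1,Y_2,\dots$ be i.i.d. random variables distributed as $U^{1/\theta}$, where $U$ is uniform on $[0,1]$, and let $J_1,J_2,\dots$ be i.i.d. fair coins with values in $\{0,1\}$ (each value with probability $\tfrac12$), independent of the sequence $(Y_i)_{i\ge1}$. Put $X_i=Y_1Y_2\cdots Y_i$ and $Z=\sum_{i\ge1}J_iX_i$; this series converges almost surely. For $\mathbf y=(y_1,y_2,\dots)$ let $\nu^\theta_{\mathbf y}$ be the (regular) conditional distribution of $Z$ given $(Y_1,Y_2,\dots)=\mathbf y$, and let $S^\theta_{\mathbf y}$ be the support of $\nu^\theta_{\mathbf y}$. Let $\mathcal L$ be Lebesgue measure on $\mathbb R$, let $\dim_H$ of a set be its Hausdorff dimension, and put $\dim_H(\nu)=\inf\{\dim_H(A):\ \nu(\mathbb R\setminus A)=0\}$ for a measure $\nu$ on $\mathbb R$. Below, "a.e. $\mathbf y$" refers to the distribution of the sequence $(Y_1,Y_2,\dots)$. Then $$S^\theta_{\mathbf y}=\Big\{\sum_{i\ge1}a_i\,y_1y_2\cdots y_i:\ a_i\in\{0,1\}\Big\}\quad\text{for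 a.e. }\mathbf y,$$ and moreover: (a) If $\theta>1/\log 2$, then for a.e. $\mathbf y$ the measure $\nu^\theta_{\mathbf y}$ is absolutely continuous with respect to $\mathcal L$ with a density in $L^2(\mathbb R)$, hence $\mathcal L(S^\theta_{\mathbf y})>0$. (b) If $\theta>2/\log 2$, then for a.e. $\mathbf y$ the measure $\nu^\theta_{\mathbf y}$ is absolutely continuous with respect to $\mathcal L$ with a continuous density, hence $S^\theta_{\mathbf y}$ contains an interval of positive length. (c) If $0<\theta\le 1/\log 2$, then for a.e. $\mathbf y$ one has $\mathcal L(S^\theta_{\mathbf y})=0$ and $\dim_H(S^\theta_{\mathbf y})=\dim_H(\nu^\theta_{\mathbf y})=\theta\log 2$. -/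

import Mathlib

open MeasureTheory ProbabilityTheory
open scoped ENNReal

noncomputable section

namespace Arratia

/-- The distribution of `U ^ (1 / θ)`, where `U` is uniformly distributed on `[0, 1]`. -/
def errorLaw (θ : ℝ) : Measure ℝ :=
  ((volume : Measure ℝ).restrict (Set.Icc 0 1)).map (fun u : ℝ => u ^ (1 / θ))

/-- The distribution of a fair coin with values `0` and `1`. -/
def coinLaw : Measure ℝ :=
  (2⁻¹ : ℝ≥0∞) • Measure.dirac (0 : ℝ) + (2⁻¹ : ℝ≥0∞) • Measure.dirac (1 : ℝ)

/-- The product of the first `i + 1` terms of the sequence `y`: with indices starting at `0`, this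
is the `i`-th of the points `X₁ = Y₁, X₂ = Y₁ Y₂, …`. -/
def point (y : ℕ → ℝ) (i : ℕ) : ℝ := ∏ j ∈ Finset.range (i + 1), y j

/-- The random sum `∑ i, J i * X i`, where `X i = Y 0 * ⋯ * Y i`. -/
def randomSum {Ω : Type*} (Y J : ℕ → Ω → ℝ) (ω : Ω) : ℝ :=
  ∑' i, J i ω * point (fun j => Y j ω) i

/-- The set of all sums `∑ i, a i * X i` with digits `a i ∈ {0, 1}`. -/
def digitSums (y : ℕ → ℝ) : Set ℝ :=
  {s | ∃ a : ℕ → ℝ, (∀ i, a i = 0 ∨ a i = 1) ∧ HasSum (fun i => a i * point y i) s}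

/-- The (regular) conditional distribution of the random sum, given that the whole process
`(Y 0, Y 1, …)` equals `y`. -/
def condLaw {Ω : Type*} [MeasurableSpace Ω] (P : Measure Ω) [IsFiniteMeasure P]
    (Y J : ℕ → Ω → ℝ) (y : ℕ → ℝ) : Measure ℝ :=
  condDistrib (randomSum Y J) (fun ω i => Y i ω) P y

/-- The Hausdorff dimension of a measure: the infimum of the Hausdorff dimensions of the sets
of full measure. -/
def measureDimH (ν : Measure ℝ) : ℝ≥0∞ :=
  ⨅ (A : Set ℝ) (_ : ν Aᶜ = 0), dimH A

/-- `f` is a (real, everywhere nonnegative) density of `ν` with respect to Lebesgue measure. -/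
def IsDensity (ν : Measure ℝ) (f : ℝ → ℝ) : Prop :=
  (∀ x, 0 ≤ f x) ∧ ν = volume.withDensity (fun x => ENNReal.ofReal (f x))

end Arratia

end

noncomputable section

open Filter Topology Metric

namespace Arratia

/-! Coins and errors are independent, so the conditional law of the sum is almost surely `partialLaw
Set.univ y`, the law of a sum over fair coins with `y` fixed (`condLaw_ae_eq`). Everything then
concerns almost every `y` under the i.i.d. law. By the strong law `point y n` is `exp (-n / θ)` up
to subexponential factors. Hence the digit sums form a compact set, all of whose cylinders are
charged: this is the support.

The regularity of the law is read off from the mass of pairs at distance at most `r`. If two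
independent coin sequences first disagree at index `n`, an event of probability at most `2⁻¹ ^ n`,
their sums differ in absolute value by `point y n * |1 + y (n + 1) * W|`, where `W` does not involve
`y (n + 1)`. The factor is at most `r` with probability `O(r)`, uniformly in `W`
(`exists_errorLaw_le`). Where `point y n ≥ c ρ ^ (n + 1)`, the averaged pair mass is thus at most `∑
2⁻¹ ^ n * min 1 (C r / (c ρ ^ (n + 1)))`, which is `O(r ^ s)` as soon as `1 / 2 < ρ ^ s`
(`lintegral_pairMass_le`). Any `ρ < exp (-1 / θ)` is allowed.

For `θ log 2 > 1` one may take `s = 1`; Fatou and differentiation of measures give a density in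
`L²`. For `θ log 2 > 2` the even and the odd digits each still give an `L²` density, and the
convolution of the two is continuous. For `θ log 2 ≤ 1` every `s < θ log 2` is allowed, and the mass
distribution principle bounds the dimension of every set of full measure from below; the covers by
`2 ^ n` intervals of length `tail y n` give the matching upper bound.

Zero length must also be shown at `θ log 2 = 1`, where the exponential rates cancel. There the
central limit theorem makes `2 ^ n * point y (n - 1)` arbitrarily small with probability bounded
below, and a renewal inequality forces the infimum of the cover lengths to vanish
(`ae_coverLength_eq_zero`). -/

/-! ### Near-diagonal mass, dimension and densities -/

/-- The mass of pairs at distance at most `r` under `ν × ν`. -/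
def pairMass (ν : Measure ℝ) (r : ℝ) : ℝ≥0∞ :=
  (ν.prod ν) {p | |p.1 - p.2| ≤ r}

lemma measurableSet_pair (r : ℝ) : MeasurableSet {p : ℝ × ℝ | |p.1 - p.2| ≤ r} :=
  measurableSet_le (by fun_prop) measurable_const

lemma pairMass_eq_lintegral (ν : Measure ℝ) [SFinite ν] (r : ℝ) :
    pairMass ν r = ∫⁻ x, ν (closedBall x r) ∂ν := by
  rw [pairMass, Measure.prod_apply (measurableSet_pair r)]
  refine lintegral_congr fun x => ?_
  congr 1
  ext y
  simp [Real.dist_eq, abs_sub_comm]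

lemma measurable_measure_closedBall (ν : Measure ℝ) [SFinite ν] (r : ℝ) :
    Measurable fun x => ν (closedBall x r) := by
  have := measurable_measure_prodMk_left (ν := ν) (measurableSet_pair r)
  convert this using 3 with x
  ext y
  simp [Real.dist_eq, abs_sub_comm]

/-- Mass distribution principle. -/
lemma le_dimH_of_measure_closedBall_le (ν : Measure ℝ) [IsFiniteMeasure ν] (hν : ν ≠ 0)
    {s : NNReal} (hs : 0 < s)
    (h : ∀ᵐ x ∂ν, ∃ C : ℕ, ∀ k : ℕ, ν (closedBall x ((1 / 2) ^ k)) ≤ C * ((1 / 2) ^ k) ^ (s : ℝ))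
    {A : Set ℝ} (hA : ν Aᶜ = 0) : (s : ℝ≥0∞) ≤ dimH A := by
  set E : ℕ → Set ℝ := fun C =>
    {x | ∀ k : ℕ, ν (closedBall x ((1 / 2) ^ k)) ≤ C * ((1 / 2) ^ k) ^ (s : ℝ)} with hE
  have hEm : ∀ C, MeasurableSet (E C) := fun C => by
    simp only [hE, Set.ofPred_forall]
    exact MeasurableSet.iInter fun k =>
      measurableSet_le (measurable_measure_closedBall ν _) measurable_const
  obtain ⟨C, hC⟩ : ∃ C, ν (E C) ≠ 0 := by
    by_contra! h0
    have h1 : ν (⋃ C, E C) = 0 := measure_iUnion_null h0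
    have h2 : ∀ᵐ x ∂ν, x ∈ ⋃ C, E C := by
      filter_upwards [h] with x ⟨C, hC⟩
      exact Set.mem_iUnion.2 ⟨C, hC⟩
    have h3 : ν Set.univ = 0 := by
      have : (Set.univ : Set ℝ) ⊆ (⋃ C, E C) ∪ (⋃ C, E C)ᶜ := by rw [Set.union_compl_self]
      exact measure_mono_null this (measure_union_null h1 h2)
    exact hν (Measure.measure_univ_eq_zero.1 h3)
  -- Rounding a diameter up to a dyadic scale costs at most a factor 2, hence `2 ^ s`; the `+ 1`
  -- keeps `K` invertible.
  set K : NNReal := (C + 1) * 2 ^ (s : ℝ) with hK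
  have hK0 : K ≠ 0 := by positivity
  have hs' : (0 : ℝ) < s := hs
  have hball : ∀ x ∈ E C, ∀ d : ℝ≥0∞, d ≤ 1 → ν {y | edist y x ≤ d} ≤ K * d ^ (s : ℝ) := by
    intro x hx d hd
    have hdt : d ≠ ∞ := ne_top_of_le_ne_top ENNReal.one_ne_top hd
    have hsub : ∀ k : ℕ, d ≤ ENNReal.ofReal ((1 / 2) ^ k) →
        ν {y | edist y x ≤ d} ≤ C * ((1 / 2) ^ k) ^ (s : ℝ) := fun k hk => by
      refine (measure_mono fun y hy => ?_).trans (hx k)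
      have : edist y x ≤ ENNReal.ofReal ((1 / 2) ^ k) := le_trans hy hk
      rwa [edist_le_ofReal (by positivity)] at this
    rcases eq_or_ne d 0 with rfl | hd0
    · have hlim : Tendsto (fun k : ℕ => (C : ℝ≥0∞) * ((1 / 2) ^ k) ^ (s : ℝ)) atTop (𝓝 0) := by
        have h1 : Tendsto (fun k : ℕ => ((1 / 2 : ℝ≥0∞) ^ k)) atTop (𝓝 0) :=
          ENNReal.tendsto_pow_atTop_nhds_zero_of_lt_one (by simp)
        have h2 := ((ENNReal.continuous_rpow_const (y := (s : ℝ))).tendsto 0).comp h1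
        rw [ENNReal.zero_rpow_of_pos hs'] at h2
        have h3 := ENNReal.Tendsto.const_mul (a := C) h2 (Or.inr (ENNReal.natCast_ne_top C))
        simpa using h3
      exact (ge_of_tendsto' hlim fun k => hsub k zero_le).trans zero_le
    · have hdr : 0 < d.toReal := ENNReal.toReal_pos hd0 hdt
      obtain ⟨k, hk1, hk2⟩ := exists_nat_pow_near_of_lt_one hdr
        (by simpa using ENNReal.toReal_mono ENNReal.one_ne_top hd)
        (show (0 : ℝ) < 1 / 2 by norm_num) (by norm_num)
      have hk2' : d ≤ ENNReal.ofReal ((1 / 2) ^ k) := (ENNReal.le_ofReal_iff_toReal_le hdt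
        (by positivity)).2 hk2
      have hk1' : (1 / 2 : ℝ≥0∞) ^ k ≤ 2 * d := by
        have h1 : ENNReal.ofReal ((1 / 2) ^ k) ≤ ENNReal.ofReal (2 * d.toReal) :=
          ENNReal.ofReal_le_ofReal (by rw [pow_succ] at hk1; linarith)
        rw [ENNReal.ofReal_mul (by norm_num), ENNReal.ofReal_toReal hdt,
          ENNReal.ofReal_pow (by norm_num), one_div, ENNReal.ofReal_inv_of_pos (by norm_num)] at h1
        simpa using h1
      calc ν {y | edist y x ≤ d} ≤ C * ((1 / 2) ^ k) ^ (s : ℝ) := hsub k hk2'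
        _ ≤ (C + 1) * (2 * d) ^ (s : ℝ) := by gcongr; exact le_self_add
        _ = K * d ^ (s : ℝ) := by
          rw [ENNReal.mul_rpow_of_nonneg _ _ hs'.le, hK, ← mul_assoc]
          push_cast
          rw [ENNReal.coe_rpow_of_nonneg _ hs'.le]
          simp
  -- A set that meets `E C` lies in a ball of radius its diameter about a point of `E C`, where the
  -- uniform ball bound applies.
  have key : (K : ℝ≥0∞)⁻¹ • ν.restrict (E C) ≤ μH[s] := by
    refine Measure.le_hausdorffMeasure _ _ 1 one_pos fun t ht => ?_
    rw [Measure.smul_apply, smul_eq_mul, Measure.restrict_apply' (hEm C)]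
    rcases (t ∩ E C).eq_empty_or_nonempty with h0 | ⟨x, hxt, hxE⟩
    · simp [h0]
    have h1 : ν (t ∩ E C) ≤ K * ediam t ^ (s : ℝ) := by
      refine (measure_mono ?_).trans (hball x hxE _ ht)
      intro y hy
      exact edist_le_ediam_of_mem hy.1 hxt
    rw [mul_comm, ← div_eq_mul_inv]
    refine ENNReal.div_le_of_le_mul ?_
    rwa [mul_comm]
  refine le_dimH_of_hausdorffMeasure_ne_zero fun h0 => hC ?_
  have h1 := (key A).trans_eq h0
  rw [Measure.smul_apply, smul_eq_mul, Measure.restrict_apply' (hEm C), le_zero_iff,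
    mul_eq_zero] at h1
  rcases h1 with h1 | h1
  · simp at h1
  · refine measure_mono_null (t := (A ∩ E C) ∪ Aᶜ) ?_ (measure_union_null h1 hA)
    intro x hx
    by_cases hxA : x ∈ A
    · exact Or.inl ⟨hxA, hx⟩
    · exact Or.inr hxA

/-- By Tonelli the left side integrates the length of the intersection of the `r`-balls about two
`ν`-points; this is at most `2 * r`, and zero unless the points are within `2 * r`. -/
lemma lintegral_sq_measure_closedBall_le (ν : Measure ℝ) [SFinite ν] (r : ℝ) :
    ∫⁻ x, ν (closedBall x r) ^ 2 ≤ ENNReal.ofReal (2 * r) * pairMass ν (2 * r) := by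
  have h1 : ∀ x, ν (closedBall x r) ^ 2 = ∫⁻ p : ℝ × ℝ,
      Set.indicator {p : ℝ × ℝ | |p.1 - x| ≤ r ∧ |p.2 - x| ≤ r} 1 p ∂(ν.prod ν) := by
    intro x
    have : {p : ℝ × ℝ | |p.1 - x| ≤ r ∧ |p.2 - x| ≤ r} = closedBall x r ×ˢ closedBall x r := by
      ext p; simp [Real.dist_eq]
    rw [this, lintegral_indicator_one (measurableSet_closedBall.prod measurableSet_closedBall),
      Measure.prod_prod, sq]
  simp_rw [h1]
  have hm : MeasurableSet {q : ℝ × (ℝ × ℝ) | |q.2.1 - q.1| ≤ r ∧ |q.2.2 - q.1| ≤ r} :=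
    .inter (s₁ := {q : ℝ × (ℝ × ℝ) | |q.2.1 - q.1| ≤ r})
      (measurableSet_le (by fun_prop) measurable_const)
      (measurableSet_le (f := fun q : ℝ × (ℝ × ℝ) => |q.2.2 - q.1|) (by fun_prop) measurable_const)
  rw [lintegral_lintegral_swap]
  swap
  · exact (measurable_one.indicator hm).aemeasurable
  rw [pairMass, ← setLIntegral_one, ← lintegral_indicator (measurableSet_pair _),
    ← lintegral_const_mul' _ _ ENNReal.ofReal_ne_top]
  refine lintegral_mono fun p => ?_
  have h2 : (fun x => Set.indicator {p : ℝ × ℝ | |p.1 - x| ≤ r ∧ |p.2 - x| ≤ r}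
      (1 : ℝ × ℝ → ℝ≥0∞) p) = Set.indicator (closedBall p.1 r ∩ closedBall p.2 r) 1 := by
    ext x
    simp [Set.indicator, Real.dist_eq, abs_sub_comm]
  rw [h2, lintegral_indicator_one (measurableSet_closedBall.inter measurableSet_closedBall)]
  by_cases hp : p ∈ {p : ℝ × ℝ | |p.1 - p.2| ≤ 2 * r}
  · rw [Set.indicator_of_mem hp, mul_one]
    exact (measure_mono Set.inter_subset_left).trans (by rw [Real.volume_closedBall])
  · have : closedBall p.1 r ∩ closedBall p.2 r = ∅ := by
      by_contra h
      obtain ⟨x, hx1, hx2⟩ := Set.nonempty_iff_ne_empty.2 h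
      apply hp
      simp only [mem_closedBall, Real.dist_eq, Set.mem_ofPred_eq, abs_le] at *
      constructor <;> linarith [hx1.1, hx1.2, hx2.1, hx2.2]
    simp [this]

/-- The scales along which balls are measured. -/
lemma tendsto_half_pow_nhdsGT : Tendsto (fun k : ℕ => ((1 : ℝ) / 2) ^ k) atTop (𝓝[>] 0) :=
  tendsto_nhdsWithin_iff.2 ⟨tendsto_pow_atTop_nhds_zero_of_lt_one (by norm_num) (by norm_num),
    Eventually.of_forall fun k => by simp⟩

/-- Fatou makes the lower density of `ν` finite `ν`-almost everywhere, which leaves no room for a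
singular part. -/
lemma absolutelyContinuous_of_liminf_pairMass (ν : Measure ℝ) [IsFiniteMeasure ν]
    (h : liminf (fun k : ℕ => 2 ^ k * pairMass ν ((1 / 2) ^ k)) atTop ≠ ∞) :
    ν ≪ volume := by
  have hfin : ∀ᵐ x ∂ν, liminf (fun k : ℕ => 2 ^ k * ν (closedBall x ((1 / 2) ^ k))) atTop ≠ ∞ := by
    have hle := lintegral_liminf_le (μ := ν) (u := atTop)
      (f := fun (k : ℕ) x => 2 ^ k * ν (closedBall x ((1 / 2) ^ k)))
      (fun k => (measurable_measure_closedBall ν _).const_mul _)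
    simp_rw [lintegral_const_mul _ (measurable_measure_closedBall ν _),
      ← pairMass_eq_lintegral] at hle
    refine (ae_lt_top ?_ (ne_top_of_le_ne_top h hle)).mono fun x hx => hx.ne
    exact Measurable.liminf fun k => (measurable_measure_closedBall ν _).const_mul _
  -- Differentiating `volume` against `ν`, rather than the reverse, works at `ν`-almost every point:
  -- a zero derivative would make `ν (ball) / length` tend to infinity.
  have hne : ∀ᵐ x ∂ν, (volume : Measure ℝ).rnDeriv ν x ≠ 0 := by
    filter_upwards [hfin, Besicovitch.ae_tendsto_rnDeriv volume ν] with x hx hlim h0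
    apply hx
    rw [h0] at hlim
    have h1 := (hlim.comp tendsto_half_pow_nhdsGT)
    have h2 : Tendsto (fun k : ℕ => 2 ^ k * ν (closedBall x ((1 / 2) ^ k))) atTop (𝓝 ∞) := by
      have h3 := (tendsto_inv_iff.2 h1)
      rw [ENNReal.inv_zero] at h3
      have h4 := ENNReal.Tendsto.const_mul (a := 2) h3 (Or.inr (by simp))
      rw [ENNReal.mul_top (by simp)] at h4
      refine h4.congr fun k => ?_
      simp only [Function.comp]
      rw [Real.volume_closedBall, ENNReal.inv_div (Or.inr ENNReal.ofReal_ne_top)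
        (Or.inr (by simp)), ENNReal.ofReal_mul (by norm_num), div_eq_mul_inv,
        ENNReal.mul_inv (by simp) (by simp), ENNReal.ofReal_pow (by norm_num)]
      have : ENNReal.ofReal (1 / 2) = 2⁻¹ := by
        rw [one_div, ENNReal.ofReal_inv_of_pos (by norm_num)]; simp
      rw [this, ← ENNReal.inv_pow, inv_inv]
      have e : ENNReal.ofReal 2 = 2 := by simp
      rw [e]
      calc (2 : ℝ≥0∞) * (ν (closedBall x ((1 / 2) ^ k)) * (2⁻¹ * 2 ^ k))
          = (2 * 2⁻¹) * (2 ^ k * ν (closedBall x ((1 / 2) ^ k))) := by ring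
        _ = _ := by rw [ENNReal.mul_inv_cancel (by simp) (by simp), one_mul]
    exact h2.liminf_eq
  exact (withDensity_absolutelyContinuous' (Measure.measurable_rnDeriv _ _).aemeasurable hne).trans
    (Measure.absolutelyContinuous_of_le (Measure.withDensity_rnDeriv_le _ _))

/-- The density is a limit of ball averages, so Fatou reduces its square integral to
`lintegral_sq_measure_closedBall_le`. The radius `(1 / 2) ^ (k + 1)` makes both the ball length and
the pair distance equal to `(1 / 2) ^ k`. -/
lemma lintegral_sq_rnDeriv_le_liminf_pairMass (ν : Measure ℝ) [IsFiniteMeasure ν] :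
    ∫⁻ x, ν.rnDeriv volume x ^ 2 ≤
      liminf (fun k : ℕ => 2 ^ k * pairMass ν ((1 / 2) ^ k)) atTop := by
  have hlim : ∀ᵐ x, Tendsto (fun k : ℕ => (2 ^ k * ν (closedBall x ((1 / 2) ^ (k + 1)))) ^ 2) atTop
      (𝓝 (ν.rnDeriv volume x ^ 2)) := by
    filter_upwards [Besicovitch.ae_tendsto_rnDeriv ν volume] with x hx
    have h1 := hx.comp (tendsto_half_pow_nhdsGT.comp (tendsto_add_atTop_nat 1))
    have h2 := ((ENNReal.continuous_pow 2).tendsto _).comp h1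
    refine h2.congr fun k => ?_
    simp only [Function.comp]
    rw [Real.volume_closedBall, show (2 : ℝ) * (1 / 2) ^ (k + 1) = (1 / 2) ^ k by
        rw [pow_succ]; ring, ENNReal.ofReal_pow (by norm_num), div_eq_mul_inv, one_div,
      ENNReal.ofReal_inv_of_pos (by norm_num), ← ENNReal.inv_pow, inv_inv, mul_comm]
    simp
  calc ∫⁻ x, ν.rnDeriv volume x ^ 2
      = ∫⁻ x, liminf (fun k : ℕ => (2 ^ k * ν (closedBall x ((1 / 2) ^ (k + 1)))) ^ 2) atTop := by
        refine lintegral_congr_ae ?_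
        filter_upwards [hlim] with x hx
        exact hx.liminf_eq.symm
    _ ≤ liminf (fun k : ℕ => ∫⁻ x, (2 ^ k * ν (closedBall x ((1 / 2) ^ (k + 1)))) ^ 2) atTop :=
        lintegral_liminf_le fun k => ((measurable_measure_closedBall ν _).const_mul _).pow_const 2
    _ ≤ _ := by
        refine liminf_le_liminf (Eventually.of_forall fun k => ?_)
        simp_rw [mul_pow]
        rw [lintegral_const_mul _ ((measurable_measure_closedBall ν _).pow_const 2)]
        refine (mul_le_mul_right (lintegral_sq_measure_closedBall_le ν _) _).trans ?_
        rw [show (2 : ℝ) * (1 / 2) ^ (k + 1) = (1 / 2) ^ k by rw [pow_succ]; ring,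
          ENNReal.ofReal_pow (by norm_num), one_div, ENNReal.ofReal_inv_of_pos (by norm_num)]
        have e : ENNReal.ofReal 2 = 2 := by simp
        rw [e, sq, mul_assoc, ← mul_assoc _ (2⁻¹ ^ k), ← mul_pow,
          ENNReal.mul_inv_cancel (by simp) (by simp), one_pow, one_mul]

/-- The series is the `ν`-integral of the sum of the normalised ball masses, so that sum is finite
almost everywhere and dominates each of its terms. -/
lemma ae_exists_measure_closedBall_le (ν : Measure ℝ) [SFinite ν] (s : ℝ)
    (h : ∑' k : ℕ, pairMass ν ((1 / 2) ^ k) / ((1 / 2) ^ k) ^ s ≠ ∞) :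
    ∀ᵐ x ∂ν, ∃ C : ℕ, ∀ k : ℕ, ν (closedBall x ((1 / 2) ^ k)) ≤ C * ((1 / 2) ^ k) ^ s := by
  have hm : ∀ k : ℕ, Measurable fun x =>
      ν (closedBall x ((1 / 2) ^ k)) * (((1 / 2 : ℝ≥0∞) ^ k) ^ s)⁻¹ :=
    fun k => (measurable_measure_closedBall ν _).mul_const _
  have heq : ∑' k : ℕ, pairMass ν ((1 / 2) ^ k) / ((1 / 2) ^ k) ^ s =
      ∫⁻ x, ∑' k : ℕ, ν (closedBall x ((1 / 2) ^ k)) * (((1 / 2 : ℝ≥0∞) ^ k) ^ s)⁻¹ ∂ν := by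
    rw [lintegral_tsum fun k => (hm k).aemeasurable]
    refine tsum_congr fun k => ?_
    rw [lintegral_mul_const _ (measurable_measure_closedBall ν _), pairMass_eq_lintegral,
      div_eq_mul_inv]
  rw [heq] at h
  filter_upwards [ae_lt_top (Measurable.tsum hm) h] with x hx
  obtain ⟨C, hC⟩ := ENNReal.exists_nat_gt hx.ne
  refine ⟨C, fun k => ?_⟩
  have h1 := (ENNReal.le_tsum k).trans hC.le
  have h0 : ((1 / 2 : ℝ≥0∞) ^ k) ^ s ≠ 0 := by
    rw [Ne, ENNReal.rpow_eq_zero_iff]; simp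
  have ht : ((1 / 2 : ℝ≥0∞) ^ k) ^ s ≠ ∞ := by
    rw [Ne, ENNReal.rpow_eq_top_iff]; simp
  rwa [← div_eq_mul_inv, ENNReal.div_le_iff h0 ht] at h1

/-! ### Convolutions of square-integrable densities -/

/-- The convolution of two square-integrable functions on the line is continuous. -/
lemma continuous_integral_mul_of_memLp_two {f g : ℝ → ℝ} (hf : MemLp f 2) (hg : MemLp g 2) :
    Continuous fun x => ∫ t, f t * g (x - t) := by
  have hmp : ∀ x : ℝ, MeasurePreserving (fun t : ℝ => x - t) volume volume :=
    fun x => Measure.measurePreserving_sub_left volume x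
  let r : C(ℝ, C(ℝ, ℝ)) := ContinuousMap.curry ⟨fun p : ℝ × ℝ => p.1 - p.2, by fun_prop⟩
  -- The convolution at `x` is the `L²` inner product of `f` with a reflected translate of `g`, and
  -- translation is continuous in `L²`.
  have hc : Continuous fun x : ℝ => Lp.compMeasurePreserving (r x) (hmp x) (hg.toLp g) :=
    continuous_const.compMeasurePreservingLp r.continuous hmp (by simp)
  have h := (continuous_const (y := hf.toLp f)).inner (𝕜 := ℝ) hc
  convert h using 1
  ext x
  rw [L2.inner_def]
  refine integral_congr_ae ?_
  filter_upwards [hf.coeFn_toLp, Lp.coeFn_compMeasurePreserving (hg.toLp g) (hmp x),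
    (hmp x).quasiMeasurePreserving.ae hg.coeFn_toLp] with t h1 h2 h3
  have h4 : (Lp.compMeasurePreserving (r x) (hmp x) (hg.toLp g)) t = g (x - t) := h2.trans h3
  rw [h4, h1]
  simp [mul_comm]

/-- The convolution of two measures with square-integrable densities has a continuous density. -/
lemma exists_continuous_isDensity_conv {μ ν : Measure ℝ} {f g : ℝ → ℝ} (hf : MemLp f 2)
    (hg : MemLp g 2) (hμ : IsDensity μ f) (hν : IsDensity ν g) :
    ∃ h : ℝ → ℝ, Continuous h ∧ IsDensity (μ ∗ ν) h := by
  refine ⟨_, continuous_integral_mul_of_memLp_two hf hg, fun x => integral_nonneg fun t =>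
    mul_nonneg (hμ.1 _) (hν.1 _), ?_⟩
  have hfm := hf.aestronglyMeasurable.aemeasurable
  have hgm := hg.aestronglyMeasurable.aemeasurable
  rw [hμ.2, hν.2, conv_withDensity_eq_mlconvolution₀ hfm.ennreal_ofReal hgm.ennreal_ofReal]
  congr 1
  ext x
  have hmp : MeasurePreserving (fun t => x - t) volume volume :=
    Measure.measurePreserving_sub_left volume x
  rw [ofReal_integral_eq_lintegral_ofReal]
  · rw [lconvolution_def]
    refine lintegral_congr fun t => ?_
    rw [ENNReal.ofReal_mul (hμ.1 t), neg_add_eq_sub]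
  · exact MemLp.integrable_mul hf (hg.comp_measurePreserving hmp)
  · exact Eventually.of_forall fun t => mul_nonneg (hμ.1 _) (hν.1 _)

lemma exists_memLp_two_isDensity (ν : Measure ℝ) [IsFiniteMeasure ν]
    (h : liminf (fun k : ℕ => 2 ^ k * pairMass ν ((1 / 2) ^ k)) atTop ≠ ∞) :
    ν ≪ volume ∧ ∃ f : ℝ → ℝ, MemLp f 2 volume ∧ IsDensity ν f := by
  have hac := absolutelyContinuous_of_liminf_pairMass ν h
  refine ⟨hac, fun x => (ν.rnDeriv volume x).toReal, ?_, fun x => ENNReal.toReal_nonneg, ?_⟩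
  · refine ⟨(Measure.measurable_rnDeriv _ _).ennreal_toReal.aestronglyMeasurable, ?_⟩
    rw [eLpNorm_lt_top_iff_lintegral_rpow_enorm_lt_top (by simp) (by simp)]
    refine lt_of_le_of_lt ?_
      ((lintegral_sq_rnDeriv_le_liminf_pairMass ν).trans_lt (lt_top_iff_ne_top.2 h))
    refine lintegral_mono fun x => ?_
    simp only [ENNReal.toReal_ofNat, ENNReal.rpow_ofNat]
    gcongr
    rw [Real.enorm_eq_ofReal ENNReal.toReal_nonneg]
    exact ENNReal.ofReal_toReal_le
  · conv_lhs => rw [← Measure.withDensity_rnDeriv_eq ν volume hac]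
    refine withDensity_congr_ae ?_
    filter_upwards [Measure.rnDeriv_lt_top ν volume] with x hx
    rw [ENNReal.ofReal_toReal hx.ne]

/-! ### Weighted series, digit sums and their cylinder covers -/

/-- The sum of the points of `y` weighted by the digits `a`. -/
def series (a y : ℕ → ℝ) : ℝ := ∑' i, a i * point y i

/-- The sum of all points of `y` from index `n` on. -/
def tail (y : ℕ → ℝ) (n : ℕ) : ℝ := ∑' i, point y (n + i)

/-- The sequence `y` without its first `n` terms. -/
def shift {α : Type*} (n : ℕ) (y : ℕ → α) : ℕ → α := fun i => y (n + i)

/-- Positive sequences whose terms have logarithms with Cesàro limit `-θ⁻¹`. -/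
structure IsTypical (θ : ℝ) (y : ℕ → ℝ) : Prop where
  pos : ∀ i, 0 < y i
  tendsto : Tendsto (fun n : ℕ => (∑ i ∈ Finset.range n, Real.log (y i)) / n) atTop (𝓝 (-θ⁻¹))

lemma point_pos {y : ℕ → ℝ} (hy : ∀ i, 0 < y i) (n : ℕ) : 0 < point y n :=
  Finset.prod_pos fun i _ => hy i

lemma point_add (y : ℕ → ℝ) (n i : ℕ) :
    point y (n + 1 + i) = point y n * point (shift (n + 1) y) i := by
  simp only [point, shift]
  rw [add_assoc (n + 1) i 1, Finset.prod_range_add]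

lemma measurable_point (n : ℕ) : Measurable fun y : ℕ → ℝ => point y n :=
  Finset.measurable_fun_prod _ fun i _ => measurable_pi_apply i

lemma measurable_tail (n : ℕ) : Measurable fun y : ℕ → ℝ => tail y n :=
  Measurable.tsum fun i => measurable_point (n + i)

lemma measurable_series : Measurable fun p : (ℕ → ℝ) × (ℕ → ℝ) => series p.1 p.2 :=
  Measurable.tsum fun i => (((measurable_pi_apply i).comp measurable_fst)).mul
    ((measurable_point i).comp measurable_snd)

lemma measurable_shift {α : Type*} [MeasurableSpace α] (n : ℕ) :
    Measurable (shift n : (ℕ → α) → ℕ → α) :=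
  measurable_pi_lambda _ fun i => measurable_pi_apply (n + i)

section Summable

variable {y : ℕ → ℝ}

lemma summable_mul_point (hy : ∀ i, 0 < y i) (hs : Summable (point y)) {a : ℕ → ℝ}
    (ha : ∀ i, |a i| ≤ 1) : Summable fun i => a i * point y i := by
  refine Summable.of_norm_bounded hs fun i => ?_
  rw [norm_mul, Real.norm_eq_abs, Real.norm_of_nonneg (point_pos hy i).le]
  exact mul_le_of_le_one_left (point_pos hy i).le (ha i)

lemma summable_point_shift (hy : ∀ i, 0 < y i) (hs : Summable (point y)) (n : ℕ) :
    Summable (point (shift (n + 1) y)) := by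
  have h1 : Summable fun i => point y (n + 1 + i) := by
    simpa [add_comm] using (summable_nat_add_iff (n + 1)).2 hs
  simp_rw [point_add] at h1
  exact (summable_mul_left_iff (point_pos hy n).ne').1 h1

lemma series_eq_sum_add (hy : ∀ i, 0 < y i) (hs : Summable (point y)) {a : ℕ → ℝ}
    (ha : ∀ i, |a i| ≤ 1) (n : ℕ) :
    series a y = ∑ i ∈ Finset.range n, a i * point y i + ∑' i, a (n + i) * point y (n + i) := by
  rw [series, ← (summable_mul_point hy hs ha).sum_add_tsum_nat_add n]
  simp [add_comm]

/-- The self-similarity of the series: factoring out the first point that can carry a nonzero digit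
leaves that digit plus a series of the same kind. -/
lemma series_eq_point_mul (hy : ∀ i, 0 < y i) (hs : Summable (point y)) {a : ℕ → ℝ}
    (ha : ∀ i, |a i| ≤ 1) (n : ℕ) (h0 : ∀ i < n, a i = 0) :
    series a y = point y n * (a n + series (shift (n + 1) a) (shift (n + 1) y)) := by
  rw [series_eq_sum_add hy hs ha (n + 1), Finset.sum_range_succ,
    Finset.sum_eq_zero fun _ hi => by rw [h0 _ (Finset.mem_range.1 hi), zero_mul], zero_add,
    mul_add, mul_comm, series, ← tsum_mul_left]
  congr 1
  refine tsum_congr fun i => ?_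
  rw [point_add, shift]
  ring

lemma tail_nonneg (hy : ∀ i, 0 < y i) (n : ℕ) : 0 ≤ tail y n :=
  tsum_nonneg fun _ => (point_pos hy _).le

lemma summable_point_add (hs : Summable (point y)) (n : ℕ) : Summable fun i => point y (n + i) := by
  simpa [add_comm] using (summable_nat_add_iff n).2 hs

lemma tail_add (y : ℕ → ℝ) (n m : ℕ) :
    tail y (n + 1 + m) = point y n * tail (shift (n + 1) y) m := by
  rw [tail, tail, ← tsum_mul_left]
  refine tsum_congr fun i => ?_
  rw [add_assoc, point_add]

lemma tendsto_tail (y : ℕ → ℝ) : Tendsto (tail y) atTop (𝓝 0) := by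
  refine (tendsto_sum_nat_add (point y)).congr fun n => ?_
  rw [tail]
  simp [add_comm]

lemma abs_tsum_digits_le_tail (hy : ∀ i, 0 < y i) (hs : Summable (point y)) {a : ℕ → ℝ}
    (ha : ∀ i, |a i| ≤ 1) (n : ℕ) : |∑' i, a (n + i) * point y (n + i)| ≤ tail y n := by
  rw [← Real.norm_eq_abs]
  refine tsum_of_norm_bounded (summable_point_add hs n).hasSum fun i => ?_
  rw [norm_mul, Real.norm_eq_abs, Real.norm_of_nonneg (point_pos hy _).le]
  exact mul_le_of_le_one_left (point_pos hy _).le (ha _)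

lemma abs_le_one_of_digit {a : ℝ} (ha : a = 0 ∨ a = 1) : |a| ≤ 1 := by
  rcases ha with h | h <;> simp [h]

lemma mem_digitSums_iff (hy : ∀ i, 0 < y i) (hs : Summable (point y)) {x : ℝ} :
    x ∈ digitSums y ↔ ∃ a : ℕ → ℝ, (∀ i, a i = 0 ∨ a i = 1) ∧ series a y = x := by
  refine exists_congr fun a => and_congr_right fun ha => ?_
  exact (summable_mul_point hy hs fun i => abs_le_one_of_digit (ha i)).hasSum_iff

/-- A continuous image of the Cantor space of Boolean sequences, by uniform convergence. -/
lemma isCompact_digitSums (hy : ∀ i, 0 < y i) (hs : Summable (point y)) :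
    IsCompact (digitSums y) := by
  have : digitSums y = Set.range fun b : ℕ → Bool => series (fun i => if b i then 1 else 0) y := by
    ext x
    rw [mem_digitSums_iff hy hs]
    constructor
    · rintro ⟨a, ha, rfl⟩
      refine ⟨fun i => decide (a i = 1), ?_⟩
      simp only
      congr 1
      funext i
      rcases ha i with h | h <;> simp [h]
    · rintro ⟨b, rfl⟩
      exact ⟨_, fun i => by simp, rfl⟩
  rw [this]
  refine isCompact_range (continuous_tsum (fun i => ?_) hs fun i b => ?_)
  · have h1 : Continuous fun c : Bool => ((if c then 1 else 0 : ℝ)) * point y i :=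
      continuous_of_discreteTopology
    exact h1.comp (continuous_apply i)
  · rw [norm_mul, Real.norm_of_nonneg (point_pos hy i).le]
    refine mul_le_of_le_one_left (point_pos hy _).le ?_
    dsimp only
    split_ifs <;> simp

/-- The finite sums from which the cylinder covers of the digit sums start. -/
def cylinderBase (y : ℕ → ℝ) (n : ℕ) (w : Fin n → Bool) : ℝ :=
  ∑ i : Fin n, (if w i then 1 else 0) * point y i

lemma digitSums_subset_iUnion (hy : ∀ i, 0 < y i) (hs : Summable (point y)) (n : ℕ) :
    digitSums y ⊆ ⋃ w : Fin n → Bool,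
      Set.Icc (cylinderBase y n w) (cylinderBase y n w + tail y n) := by
  intro x hx
  obtain ⟨a, ha, rfl⟩ := (mem_digitSums_iff hy hs).1 hx
  have ha1 : ∀ i, |a i| ≤ 1 := fun i => abs_le_one_of_digit (ha i)
  refine Set.mem_iUnion.2 ⟨fun i => decide (a i = 1), ?_⟩
  have hb : cylinderBase y n (fun i => decide (a i = 1)) =
      ∑ i ∈ Finset.range n, a i * point y i := by
    rw [cylinderBase, Finset.sum_range]
    refine Finset.sum_congr rfl fun i _ => ?_
    rcases ha i with h | h <;> simp [h]
  have h0 : 0 ≤ ∑' i, a (n + i) * point y (n + i) := tsum_nonneg fun i =>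
    mul_nonneg (by rcases ha (n + i) with h | h <;> simp [h]) (point_pos hy _).le
  have h1 := (le_abs_self _).trans (abs_tsum_digits_le_tail hy hs ha1 n)
  rw [hb, series_eq_sum_add hy hs ha1 n]
  constructor <;> linarith

lemma volume_digitSums_le (hy : ∀ i, 0 < y i) (hs : Summable (point y)) (n : ℕ) :
    volume (digitSums y) ≤ ENNReal.ofReal (2 ^ n * tail y n) := by
  refine (measure_mono (digitSums_subset_iUnion hy hs n)).trans
    ((measure_iUnion_fintype_le _ _).trans ?_)
  simp [Real.volume_Icc, ENNReal.ofReal_mul, ENNReal.ofReal_pow]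

end Summable

/-! ### Exponential decay along typical sequences; upper dimension bound -/

section Typical

variable {θ : ℝ} {y : ℕ → ℝ}

lemma log_point (hy : ∀ i, 0 < y i) (n : ℕ) :
    Real.log (point y n) = ∑ i ∈ Finset.range (n + 1), Real.log (y i) :=
  Real.log_prod fun i _ => (hy i).ne'

lemma IsTypical.exists_mul_pow_le_point (h : IsTypical θ y) {ρ : ℝ} (hρ : 0 < ρ)
    (hlt : Real.log ρ < -θ⁻¹) : ∃ c > 0, ∀ n, c * ρ ^ (n + 1) ≤ point y n := by
  have h1 : ∀ᶠ n : ℕ in atTop, ρ ^ (n + 1) ≤ point y n := by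
    filter_upwards [(h.tendsto.comp (tendsto_add_atTop_nat 1)).eventually_const_lt hlt] with n hn
    have hn0 : (0 : ℝ) < ((n + 1 : ℕ) : ℝ) := by positivity
    rw [Function.comp, lt_div_iff₀ hn0, ← log_point h.pos] at hn
    rw [← Real.log_le_log_iff (by positivity) (point_pos h.pos n), Real.log_pow]
    linarith
  -- Since all points are positive, a constant absorbs the finitely many exceptional indices.
  obtain ⟨C, hC, hb⟩ := Asymptotics.bound_of_isBigO_nat_atTop
    (f := fun n => ρ ^ (n + 1)) (g'' := fun n => point y n) (Asymptotics.IsBigO.of_bound 1 (by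
      filter_upwards [h1] with n hn
      rw [Real.norm_of_nonneg (by positivity), Real.norm_of_nonneg (point_pos h.pos n).le]
      simpa using hn))
  refine ⟨C⁻¹, by positivity, fun n => ?_⟩
  have := hb (x := n) (point_pos h.pos n).ne'
  rw [Real.norm_of_nonneg (by positivity), Real.norm_of_nonneg (point_pos h.pos n).le] at this
  rw [inv_mul_le_iff₀ hC]
  exact this

lemma IsTypical.exists_point_le_mul_pow (h : IsTypical θ y) {ρ : ℝ} (hρ : 0 < ρ)
    (hlt : -θ⁻¹ < Real.log ρ) : ∃ C > 0, ∀ n, point y n ≤ C * ρ ^ n := by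
  have h1 : ∀ᶠ n : ℕ in atTop, point y n ≤ ρ * ρ ^ n := by
    filter_upwards [(h.tendsto.comp (tendsto_add_atTop_nat 1)).eventually_lt_const hlt] with n hn
    have hn0 : (0 : ℝ) < ((n + 1 : ℕ) : ℝ) := by positivity
    rw [Function.comp, div_lt_iff₀ hn0, ← log_point h.pos] at hn
    rw [← pow_succ', ← Real.log_le_log_iff (point_pos h.pos n) (by positivity), Real.log_pow]
    linarith
  obtain ⟨C, hC, hb⟩ := Asymptotics.bound_of_isBigO_nat_atTop
    (f := fun n => point y n) (g'' := fun n => ρ ^ n) (Asymptotics.IsBigO.of_bound ρ (by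
      filter_upwards [h1] with n hn
      rw [Real.norm_of_nonneg (point_pos h.pos n).le, Real.norm_of_nonneg (by positivity)]
      exact hn))
  refine ⟨C, hC, fun n => ?_⟩
  have := hb (x := n) (by positivity)
  rwa [Real.norm_of_nonneg (point_pos h.pos n).le, Real.norm_of_nonneg (by positivity)] at this

lemma IsTypical.exists_tail_le_mul_pow (h : IsTypical θ y) {ρ : ℝ} (hρ : 0 < ρ) (hρ1 : ρ < 1)
    (hlt : -θ⁻¹ < Real.log ρ) : Summable (point y) ∧ ∃ C > 0, ∀ n, tail y n ≤ C * ρ ^ n := by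
  obtain ⟨C, hC, hb⟩ := h.exists_point_le_mul_pow hρ hlt
  have hg := summable_geometric_of_lt_one hρ.le hρ1
  have hs : Summable (point y) :=
    Summable.of_nonneg_of_le (fun i => (point_pos h.pos i).le) hb (hg.mul_left C)
  refine ⟨hs, C * (1 - ρ)⁻¹, mul_pos hC (inv_pos.2 (by linarith)), fun n => ?_⟩
  rw [tail]
  calc ∑' i, point y (n + i) ≤ ∑' i, (C * ρ ^ n) * ρ ^ i :=
        (summable_point_add hs n).tsum_le_tsum
          (fun i => (hb _).trans_eq (by rw [pow_add]; ring)) (hg.mul_left _)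
    _ = _ := by rw [tsum_mul_left, tsum_geometric_of_lt_one hρ.le hρ1]; ring

lemma IsTypical.summable (hθ : 0 < θ) (h : IsTypical θ y) : Summable (point y) := by
  have hinv : 0 < θ⁻¹ := inv_pos.2 hθ
  refine (h.exists_tail_le_mul_pow (ρ := Real.exp (-(θ⁻¹ / 2))) (Real.exp_pos _)
    (Real.exp_lt_one_iff.2 (by linarith)) ?_).1
  rw [Real.log_exp]
  linarith

lemma IsTypical.dimH_digitSums_le (hθ : 0 < θ) (h : IsTypical θ y) :
    dimH (digitSums y) ≤ ENNReal.ofReal (θ * Real.log 2) := by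
  refine dimH_le fun d hd => ?_
  by_contra! hlt
  have hl2 : 0 < Real.log 2 := Real.log_pos one_lt_two
  have hd' : θ * Real.log 2 < d := by
    rw [← ENNReal.ofReal_coe_nnreal, ENNReal.ofReal_lt_ofReal_iff_of_nonneg (by positivity)] at hlt
    exact hlt
  have hd0 : (0 : ℝ) < d := lt_trans (by positivity) hd'
  -- With `ρ = exp l`, the left inequality gives `tail y n = O(ρ ^ n)` and the right one `2 * ρ ^ d
  -- < 1`, so the `d`-sums of the `2 ^ n` covering intervals tend to zero.
  obtain ⟨l, hl1, hl2'⟩ : ∃ l, -θ⁻¹ < l ∧ l < -(Real.log 2 / d) := exists_between (by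
    rw [neg_lt_neg_iff, div_lt_iff₀ hd0, inv_mul_eq_div, lt_div_iff₀ hθ]
    linarith)
  have hl0 : l < 0 := hl2'.trans (by rw [neg_lt_zero]; positivity)
  obtain ⟨hs, C, hC, hb⟩ := h.exists_tail_le_mul_pow (ρ := Real.exp l) (Real.exp_pos _)
    (Real.exp_lt_one_iff.2 hl0) (by rwa [Real.log_exp])
  have hH : μH[(d : ℝ)] (digitSums y) ≤ liminf (fun n : ℕ => ∑ w : Fin n → Bool,
      ediam (Set.Icc (cylinderBase y n w) (cylinderBase y n w + tail y n)) ^ (d : ℝ)) atTop := by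
    refine Measure.hausdorffMeasure_le_liminf_sum _ _ (fun n => ENNReal.ofReal (tail y n)) ?_
      (fun n w => Set.Icc (cylinderBase y n w) (cylinderBase y n w + tail y n)) ?_ ?_
    · simpa [Function.comp_def] using (ENNReal.continuous_ofReal.tendsto _).comp (tendsto_tail y)
    · exact Eventually.of_forall fun n w => by simp [Real.ediam_Icc]
    · exact Eventually.of_forall fun n => digitSums_subset_iUnion h.pos hs n
  have hlim : Tendsto (fun n : ℕ => ENNReal.ofReal (C ^ (d : ℝ) * (2 * Real.exp (l * d)) ^ n)) atTop
      (𝓝 0) := by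
    have h1 : Tendsto (fun n : ℕ => C ^ (d : ℝ) * (2 * Real.exp (l * d)) ^ n) atTop
        (𝓝 (C ^ (d : ℝ) * 0)) := by
      refine Tendsto.const_mul _ (tendsto_pow_atTop_nhds_zero_of_lt_one (by positivity) ?_)
      rw [← Real.exp_log two_pos, ← Real.exp_add]
      refine Real.exp_lt_one_iff.2 ?_
      have := (mul_lt_mul_of_pos_right hl2' hd0)
      rw [neg_mul, div_mul_cancel₀ _ hd0.ne'] at this
      linarith
    rw [mul_zero] at h1
    simpa [Function.comp_def] using (ENNReal.continuous_ofReal.tendsto _).comp h1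
  have hle : ∀ n : ℕ, (∑ w : Fin n → Bool,
      ediam (Set.Icc (cylinderBase y n w) (cylinderBase y n w + tail y n)) ^ (d : ℝ)) ≤
      ENNReal.ofReal (C ^ (d : ℝ) * (2 * Real.exp (l * d)) ^ n) := fun n => by
    simp only [Real.ediam_Icc, add_sub_cancel_left, Finset.sum_const, Finset.card_univ,
      Fintype.card_fun, Fintype.card_bool, Fintype.card_fin, nsmul_eq_mul]
    rw [ENNReal.ofReal_rpow_of_nonneg (tail_nonneg h.pos n) hd0.le, ← ENNReal.ofReal_natCast,
      ← ENNReal.ofReal_mul (by positivity)]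
    refine ENNReal.ofReal_le_ofReal ?_
    calc ((2 ^ n : ℕ) : ℝ) * tail y n ^ (d : ℝ) ≤ 2 ^ n * (C * Real.exp l ^ n) ^ (d : ℝ) := by
          push_cast
          gcongr
          · exact tail_nonneg h.pos n
          · exact hb n
      _ = _ := by
          rw [Real.mul_rpow hC.le (by positivity), ← Real.rpow_natCast, ← Real.rpow_natCast,
            ← Real.rpow_natCast, ← Real.exp_mul, ← Real.exp_mul,
            Real.mul_rpow two_pos.le (Real.exp_pos _).le, ← Real.exp_mul]
          ring_nf
  have h0 : μH[(d : ℝ)] (digitSums y) ≤ 0 := by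
    refine hH.trans ((liminf_le_liminf (Eventually.of_forall hle)).trans ?_)
    rw [hlim.liminf_eq]
  rw [le_zero_iff.1 h0] at hd
  exact ENNReal.zero_ne_top hd

end Typical

/-! ### The law of a single error -/

section ErrorLaw

variable (θ : ℝ)

lemma measurable_rpow_inv : Measurable fun u : ℝ => u ^ (1 / θ) := measurable_id.pow_const _

instance : IsProbabilityMeasure ((volume : Measure ℝ).restrict (Set.Icc 0 1)) :=
  ⟨by simp⟩

instance : IsProbabilityMeasure (errorLaw θ) :=
  Measure.isProbabilityMeasure_map (measurable_rpow_inv θ).aemeasurable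

lemma ae_restrict_Icc_pos : ∀ᵐ u ∂((volume : Measure ℝ).restrict (Set.Icc 0 1)), 0 < u := by
  rw [ae_restrict_iff' measurableSet_Icc]
  filter_upwards [Measure.ae_ne volume (0 : ℝ)] with u hu hu'
  exact lt_of_le_of_ne hu'.1 hu.symm

lemma ae_errorLaw_pos : ∀ᵐ u ∂(errorLaw θ), 0 < u := by
  rw [errorLaw, ae_map_iff (measurable_rpow_inv θ).aemeasurable measurableSet_Ioi]
  filter_upwards [ae_restrict_Icc_pos] with u hu
  exact Real.rpow_pos_of_pos hu _

lemma log_rpow_ae_eq : (fun u : ℝ => Real.log (u ^ (1 / θ)))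
    =ᵐ[(volume : Measure ℝ).restrict (Set.Icc 0 1)] fun u => θ⁻¹ * Real.log u := by
  filter_upwards [ae_restrict_Icc_pos] with u hu
  rw [Real.log_rpow hu, one_div]

lemma integrable_log_errorLaw : Integrable Real.log (errorLaw θ) := by
  rw [errorLaw, integrable_map_measure Real.measurable_log.aestronglyMeasurable
    (measurable_rpow_inv θ).aemeasurable]
  refine Integrable.congr ?_ (log_rpow_ae_eq θ).symm
  refine Integrable.const_mul ?_ _
  have := (intervalIntegral.intervalIntegrable_log' (a := 0) (b := 1))
  rw [intervalIntegrable_iff_integrableOn_Icc_of_le zero_le_one] at this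
  exact this

lemma integral_log_errorLaw : ∫ u, Real.log u ∂(errorLaw θ) = -θ⁻¹ := by
  rw [errorLaw, integral_map (measurable_rpow_inv θ).aemeasurable
    Real.measurable_log.aestronglyMeasurable, integral_congr_ae (log_rpow_ae_eq θ),
    integral_const_mul, integral_Icc_eq_integral_Ioc, ← intervalIntegral.integral_of_le zero_le_one,
    integral_log]
  simp

lemma exists_rpow_sub_rpow_le : ∃ L ≥ 0, ∀ r : ℝ, 0 ≤ r → r ≤ 1 / 2 →
    (1 + r) ^ θ - (1 - r) ^ θ ≤ L * r := by
  have hd : ∀ x ∈ Set.Icc (1 / 2 : ℝ) (3 / 2),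
      HasDerivWithinAt (fun x : ℝ => x ^ θ) (θ * x ^ (θ - 1)) (Set.Icc (1 / 2 : ℝ) (3 / 2)) x :=
    fun x hx => (Real.hasDerivAt_rpow_const
      (Or.inl (by have := hx.1; intro h; rw [h] at this; norm_num at this))).hasDerivWithinAt
  obtain ⟨L, hL⟩ := (isCompact_Icc (a := (1 / 2 : ℝ)) (b := 3 / 2)).exists_bound_of_continuousOn
    (f := fun x : ℝ => θ * x ^ (θ - 1)) (continuousOn_const.mul
      (continuousOn_id.rpow_const fun x hx => Or.inl (by
        have := hx.1; intro h; simp only [id] at h; rw [h] at this; norm_num at this)))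
  have hL0 : 0 ≤ L := (norm_nonneg _).trans (hL 1 (by norm_num))
  refine ⟨2 * L, by positivity, fun r hr0 hr => ?_⟩
  have := (convex_Icc (1 / 2 : ℝ) (3 / 2)).norm_image_sub_le_of_norm_hasDerivWithin_le hd hL
    (x := 1 - r) (y := 1 + r) ⟨by linarith, by linarith⟩ ⟨by linarith, by linarith⟩
  refine (le_abs_self _).trans (this.trans_eq ?_)
  rw [show 1 + r - (1 - r) = 2 * r by ring, Real.norm_of_nonneg (by positivity)]
  ring

/-- The uniformity in `w` is the point. For `r ≤ 1 / 2` the event is null unless `-w ≥ 1 / 2`,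
because the error is at most 1; then the uniform variable lies in an interval of length at most `L *
r / (-w) ^ θ`, and `(-w) ^ (-θ) ≤ 2 ^ θ`. -/
lemma exists_errorLaw_le {θ : ℝ} (hθ : 0 < θ) : ∃ C > 0, ∀ w r : ℝ, 0 ≤ r →
    errorLaw θ {u | |1 + u * w| ≤ r} ≤ ENNReal.ofReal (C * r) := by
  obtain ⟨L, hL0, hL⟩ := exists_rpow_sub_rpow_le θ
  refine ⟨2 + L * 2 ^ θ, by positivity, fun w r hr0 => ?_⟩
  rcases lt_or_ge (1 / 2) r with hr | hr
  -- The summand 2 in the constant covers large `r` trivially.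
  · refine prob_le_one.trans ?_
    rw [ENNReal.one_le_ofReal]
    have : 0 ≤ L * 2 ^ θ * r := by positivity
    linarith
  have hm : MeasurableSet {u : ℝ | |1 + u * w| ≤ r} :=
    measurableSet_le (by fun_prop) measurable_const
  rw [errorLaw, Measure.map_apply (measurable_rpow_inv θ) hm]
  rw [Measure.restrict_apply (measurable_rpow_inv θ hm)]
  rcases le_or_gt (1 / 2) (-w) with hw | hw
  · have hw0 : 0 < -w := by linarith
    have hsub : (fun u : ℝ => u ^ (1 / θ)) ⁻¹' {u | |1 + u * w| ≤ r} ∩ Set.Icc 0 1 ⊆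
        Set.Icc (((1 - r) / (-w)) ^ θ) (((1 + r) / (-w)) ^ θ) := by
      rintro v ⟨hv, hv0, -⟩
      have hv' : |1 + v ^ (1 / θ) * w| ≤ r := hv
      rw [abs_le] at hv'
      have e : v = (v ^ (1 / θ)) ^ θ := by
        rw [← Real.rpow_mul hv0, one_div_mul_cancel hθ.ne', Real.rpow_one]
      constructor
      · rw [e]
        refine Real.rpow_le_rpow (div_nonneg (by linarith) hw0.le) ?_ hθ.le
        rw [div_le_iff₀ hw0]
        linarith
      · rw [e]
        refine Real.rpow_le_rpow (by positivity) ?_ hθ.le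
        rw [le_div_iff₀ hw0]
        linarith
    refine (measure_mono hsub).trans ?_
    rw [Real.volume_Icc]
    refine ENNReal.ofReal_le_ofReal ?_
    rw [Real.div_rpow (by linarith) hw0.le, Real.div_rpow (by linarith) hw0.le, ← sub_div]
    have h1 : ((-w) ^ θ)⁻¹ ≤ 2 ^ θ := by
      rw [← Real.inv_rpow hw0.le]
      refine Real.rpow_le_rpow (by positivity) ?_ hθ.le
      rw [inv_le_comm₀ hw0 two_pos]
      linarith
    have h2 : 0 < (-w) ^ θ := by positivity
    calc ((1 + r) ^ θ - (1 - r) ^ θ) / (-w) ^ θ ≤ (L * r) * ((-w) ^ θ)⁻¹ := by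
          rw [div_eq_mul_inv]
          gcongr
          exact hL r hr0 hr
      _ ≤ (L * r) * 2 ^ θ := by gcongr
      _ ≤ _ := by nlinarith
  · have hsub : (fun u : ℝ => u ^ (1 / θ)) ⁻¹' {u | |1 + u * w| ≤ r} ∩ Set.Icc 0 1 = ∅ := by
      refine Set.eq_empty_iff_forall_notMem.2 ?_
      rintro v ⟨hv, hv0, hv1⟩
      have hv' : |1 + v ^ (1 / θ) * w| ≤ r := hv
      rw [abs_le] at hv'
      have h0 : 0 ≤ v ^ (1 / θ) := by positivity
      have h1 : v ^ (1 / θ) ≤ 1 := Real.rpow_le_one hv0 hv1 (by positivity)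
      rcases h0.eq_or_lt with h2 | h2
      · rw [← h2] at hv'
        linarith [hv'.2]
      · nlinarith [mul_pos h2 (show 0 < 1 / 2 + w by linarith)]
    rw [hsub]
    simp

end ErrorLaw

/-! ### Product laws of errors and coins; the strong law -/

section Products

/-- The law of the process of errors. -/
def errorSeqLaw (θ : ℝ) : Measure (ℕ → ℝ) := Measure.infinitePi fun _ => errorLaw θ

instance (θ : ℝ) : IsProbabilityMeasure (errorSeqLaw θ) := by
  unfold errorSeqLaw; infer_instance

instance : IsProbabilityMeasure coinLaw := ⟨by simp [coinLaw, ENNReal.inv_two_add_inv_two]⟩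

/-- The law of the process of coins. -/
def coinSeqLaw : Measure (ℕ → ℝ) := Measure.infinitePi fun _ => coinLaw

instance : IsProbabilityMeasure coinSeqLaw := by
  unfold coinSeqLaw; infer_instance

lemma ae_eval_infinitePi {μ : Measure ℝ} [IsProbabilityMeasure μ] {p : ℝ → Prop}
    (h : ∀ᵐ x ∂μ, p x) : ∀ᵐ y ∂(Measure.infinitePi fun _ : ℕ => μ), ∀ i, p (y i) :=
  ae_all_iff.2 fun i =>
    (measurePreserving_eval_infinitePi (fun _ : ℕ => μ) i).quasiMeasurePreserving.ae h

lemma ae_coinSeqLaw : ∀ᵐ a ∂coinSeqLaw, ∀ i, a i = 0 ∨ a i = 1 := by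
  refine ae_eval_infinitePi (μ := coinLaw) (p := fun x => x = 0 ∨ x = 1) ?_
  rw [coinLaw, ae_add_measure_iff]
  constructor <;> refine Measure.ae_smul_measure ?_ _ <;> rw [ae_dirac_eq] <;> simp

lemma coinLaw_singleton {b : ℝ} (hb : b = 0 ∨ b = 1) : coinLaw {b} = 2⁻¹ := by
  rcases hb with rfl | rfl <;> simp [coinLaw]

lemma coinSeqLaw_cylinder (s : Finset ℕ) {b : ℕ → ℝ} (hb : ∀ i, b i = 0 ∨ b i = 1) :
    coinSeqLaw {a | ∀ i ∈ s, a i = b i} = 2⁻¹ ^ s.card := by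
  have : {a : ℕ → ℝ | ∀ i ∈ s, a i = b i} = Set.pi s fun i => {b i} := by
    ext a; simp
  rw [this, coinSeqLaw, Measure.infinitePi_pi _ fun i _ => measurableSet_singleton _]
  simp [coinLaw_singleton (hb _)]

lemma measurableSet_agree (s : Finset ℕ) :
    MeasurableSet {p : (ℕ → ℝ) × (ℕ → ℝ) | ∀ i ∈ s, p.2 i = p.1 i} := by
  have : {p : (ℕ → ℝ) × (ℕ → ℝ) | ∀ i ∈ s, p.2 i = p.1 i} =
      ⋂ i ∈ s, {p : (ℕ → ℝ) × (ℕ → ℝ) | p.2 i = p.1 i} := by ext; simp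
  rw [this]
  exact Finset.measurableSet_biInter _ fun i _ => measurableSet_eq_fun (by fun_prop) (by fun_prop)

lemma coinSeqLaw_prod_agree (s : Finset ℕ) :
    (coinSeqLaw.prod coinSeqLaw) {p | ∀ i ∈ s, p.2 i = p.1 i} = 2⁻¹ ^ s.card := by
  rw [Measure.prod_apply (measurableSet_agree s), lintegral_congr_ae (g := fun _ => 2⁻¹ ^ s.card)]
  · simp
  · filter_upwards [ae_coinSeqLaw] with b hb
    exact coinSeqLaw_cylinder s hb

lemma measurePreserving_shift (θ : ℝ) (n : ℕ) :
    MeasurePreserving (shift n) (errorSeqLaw θ) (errorSeqLaw θ) := by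
  refine ⟨measurable_shift n, ?_⟩
  exact Measure.map_infinitePi_infinitePi_of_inj (P := fun _ => errorLaw θ)
    (add_right_injective n)

/-- The sequence with first term `p.1`, followed by the terms of `p.2`. -/
def cons (p : ℝ × (ℕ → ℝ)) : ℕ → ℝ
  | 0 => p.1
  | i + 1 => p.2 i

lemma measurable_cons : Measurable cons := by
  refine measurable_pi_lambda _ fun i => ?_
  cases i with
  | zero => exact measurable_fst
  | succ i => exact (measurable_pi_apply i).comp measurable_snd

lemma shift_cons (p : ℝ × (ℕ → ℝ)) : shift 1 (cons p) = p.2 := by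
  ext i
  rw [shift, add_comm]
  rfl

/-- Isolates the first error, so that Tonelli can integrate over it with all later errors frozen. -/
lemma measurePreserving_cons (θ : ℝ) :
    MeasurePreserving cons ((errorLaw θ).prod (errorSeqLaw θ)) (errorSeqLaw θ) := by
  refine ⟨measurable_cons, Measure.eq_infinitePi _ fun s t ht => ?_⟩
  obtain ⟨N, hN⟩ := s.exists_nat_subset_range
  set t' : ℕ → Set ℝ := fun i => if i ∈ s then t i else Set.univ with ht'
  have ht'm : ∀ i, MeasurableSet (t' i) := fun i => by
    simp only [ht']; split_ifs; exacts [ht i, MeasurableSet.univ]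
  have hpre : cons ⁻¹' Set.pi s t = t' 0 ×ˢ Set.pi (Finset.range N) fun i => t' (i + 1) := by
    ext p
    simp only [Set.mem_preimage, Set.mem_pi, Finset.mem_coe, Set.mem_prod, Finset.mem_range, ht']
    constructor
    · intro h
      refine ⟨?_, fun i _ => ?_⟩
      · split_ifs with h0
        exacts [h 0 h0, Set.mem_univ _]
      · split_ifs with h0
        exacts [h (i + 1) h0, Set.mem_univ _]
    · rintro ⟨h0, h1⟩ i hi
      cases i with
      | zero => rw [if_pos hi] at h0; exact h0
      | succ i =>
        have := h1 i (by have := Finset.mem_range.1 (hN hi); omega)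
        rw [if_pos hi] at this
        exact this
  rw [Measure.map_apply measurable_cons (MeasurableSet.pi s.countable_toSet fun i _ => ht i), hpre,
    Measure.prod_prod, errorSeqLaw, Measure.infinitePi_pi _ fun i _ => ht'm _]
  have h1 : errorLaw θ (t' 0) * ∏ i ∈ Finset.range N, errorLaw θ (t' (i + 1)) =
      ∏ i ∈ Finset.range (N + 1), errorLaw θ (t' i) := by
    rw [Finset.prod_range_succ', mul_comm]
  rw [h1, ← Finset.prod_subset (hN.trans (Finset.range_mono N.le_succ))]
  · exact Finset.prod_congr rfl fun i hi => by simp only [ht', if_pos hi]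
  · intro i _ hi
    simp only [ht', if_neg hi, measure_univ]

lemma measurePreserving_eval (θ : ℝ) (i : ℕ) :
    MeasurePreserving (fun y : ℕ → ℝ => y i) (errorSeqLaw θ) (errorLaw θ) :=
  measurePreserving_eval_infinitePi (fun _ : ℕ => errorLaw θ) i

lemma identDistrib_log (θ : ℝ) (i : ℕ) :
    IdentDistrib (fun y : ℕ → ℝ => Real.log (y i)) (fun y => Real.log (y 0))
      (errorSeqLaw θ) (errorSeqLaw θ) :=
  IdentDistrib.comp (u := Real.log) ⟨(measurePreserving_eval θ i).measurable.aemeasurable,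
    (measurePreserving_eval θ 0).measurable.aemeasurable,
    by rw [(measurePreserving_eval θ i).map_eq, (measurePreserving_eval θ 0).map_eq]⟩
    Real.measurable_log

lemma iIndepFun_log (θ : ℝ) :
    iIndepFun (fun i (y : ℕ → ℝ) => Real.log (y i)) (errorSeqLaw θ) :=
  iIndepFun_infinitePi (P := fun _ : ℕ => errorLaw θ) (X := fun _ => Real.log)
    fun _ => Real.measurable_log

lemma integral_log_eval (θ : ℝ) : ∫ y, Real.log (y 0) ∂(errorSeqLaw θ) = -θ⁻¹ := by
  rw [← integral_log_errorLaw θ, ← (measurePreserving_eval θ 0).map_eq, integral_map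
    (measurePreserving_eval θ 0).measurable.aemeasurable Real.measurable_log.aestronglyMeasurable]

lemma ae_errorSeqLaw_pos (θ : ℝ) : ∀ᵐ y ∂(errorSeqLaw θ), ∀ i, 0 < y i :=
  ae_eval_infinitePi (ae_errorLaw_pos θ)

lemma ae_isTypical (θ : ℝ) : ∀ᵐ y ∂(errorSeqLaw θ), IsTypical θ y := by
  have hint : Integrable (fun y : ℕ → ℝ => Real.log (y 0)) (errorSeqLaw θ) :=
    (measurePreserving_eval θ 0).integrable_comp_of_integrable (integrable_log_errorLaw θ)
  filter_upwards [strong_law_ae_real _ hint (fun i j hij => (iIndepFun_log θ).indepFun hij)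
    (identDistrib_log θ), ae_errorSeqLaw_pos θ] with y h1 h2
  exact ⟨h2, by rwa [integral_log_eval θ] at h1⟩

end Products

/-! ### Averaged near-diagonal mass of the coin sums -/

/-- The law of the sum of those points of `y` with index in `I` that are selected by fair coins. -/
def partialLaw (I : Set ℕ) (y : ℕ → ℝ) : Measure ℝ :=
  coinSeqLaw.map fun a => series (I.indicator a) y

/-- The sequences whose points decay at most geometrically. -/
def slowDecay (c ρ : ℝ) : Set (ℕ → ℝ) := {y | ∀ n, c * ρ ^ (n + 1) ≤ point y n}

lemma measurableSet_slowDecay (c ρ : ℝ) : MeasurableSet (slowDecay c ρ) := by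
  simp only [slowDecay, Set.ofPred_forall]
  exact MeasurableSet.iInter fun n => measurableSet_le measurable_const (measurable_point n)

lemma measurable_indicator_digits (I : Set ℕ) :
    Measurable fun a : ℕ → ℝ => I.indicator a := by
  classical
  refine measurable_pi_lambda _ fun i => ?_
  by_cases hi : i ∈ I
  · simpa [Set.indicator, hi] using measurable_pi_apply i
  · simp [Set.indicator, hi]

lemma measurable_partialSeries (I : Set ℕ) :
    Measurable fun p : (ℕ → ℝ) × (ℕ → ℝ) => series (I.indicator p.1) p.2 :=
  measurable_series.comp (((measurable_indicator_digits I).comp measurable_fst).prodMk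
    measurable_snd)

instance (I : Set ℕ) (y : ℕ → ℝ) : IsProbabilityMeasure (partialLaw I y) :=
  Measure.isProbabilityMeasure_map
    ((measurable_partialSeries I).comp (measurable_id.prodMk measurable_const)).aemeasurable

lemma measurableSet_closePair (I : Set ℕ) (r : ℝ) :
    MeasurableSet {q : (ℕ → ℝ) × ((ℕ → ℝ) × (ℕ → ℝ)) |
      |series (I.indicator q.2.1) q.1 - series (I.indicator q.2.2) q.1| ≤ r} := by
  refine measurableSet_le (Measurable.abs (Measurable.sub ?_ ?_)) measurable_const
  · exact (measurable_partialSeries I).comp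
      ((measurable_fst.comp measurable_snd).prodMk measurable_fst)
  · exact (measurable_partialSeries I).comp
      ((measurable_snd.comp measurable_snd).prodMk measurable_fst)

lemma pairMass_partialLaw (I : Set ℕ) (y : ℕ → ℝ) (r : ℝ) :
    pairMass (partialLaw I y) r = (coinSeqLaw.prod coinSeqLaw)
      (Prod.mk y ⁻¹'
        {q | |series (I.indicator q.2.1) q.1 - series (I.indicator q.2.2) q.1| ≤ r}) := by
  have hm : Measurable fun a => series (I.indicator a) y :=
    (measurable_partialSeries I).comp (measurable_id.prodMk measurable_const)
  rw [pairMass, partialLaw, Measure.map_prod_map _ _ hm hm,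
    Measure.map_apply (hm.prodMap hm) (measurableSet_pair r)]
  rfl

lemma measurable_pairMass_partialLaw (I : Set ℕ) (r : ℝ) :
    Measurable fun y => pairMass (partialLaw I y) r := by
  simp_rw [pairMass_partialLaw]
  exact measurable_measure_prodMk_left (measurableSet_closePair I r)

lemma errorSeqLaw_near_zero_le {θ C : ℝ}
    (hC : ∀ w r : ℝ, 0 ≤ r → errorLaw θ {u | |1 + u * w| ≤ r} ≤ ENNReal.ofReal (C * r))
    {r : ℝ} (hr : 0 ≤ r) (δ e₀ : ℝ) (e : ℕ → ℝ) :
    errorSeqLaw θ {y | |1 + y 0 * (δ * (e₀ + series e (shift 1 y)))| ≤ r} ≤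
      ENNReal.ofReal (C * r) := by
  have hms : Measurable fun y => series e y :=
    measurable_series.comp (measurable_const.prodMk measurable_id)
  have hm : MeasurableSet {y : ℕ → ℝ | |1 + y 0 * (δ * (e₀ + series e (shift 1 y)))| ≤ r} := by
    have := hms.comp (measurable_shift (α := ℝ) 1)
    simp only [Function.comp_def] at this
    exact measurableSet_le (by fun_prop) measurable_const
  rw [← (measurePreserving_cons θ).measure_preimage hm.nullMeasurableSet,
    Measure.prod_apply_symm (measurable_cons hm)]
  calc _ ≤ ∫⁻ _, ENNReal.ofReal (C * r) ∂(errorSeqLaw θ) := by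
        refine lintegral_mono fun y => ?_
        refine le_of_eq_of_le ?_ (hC (δ * (e₀ + series e y)) r hr)
        congr 1
        ext u
        simp only [Set.mem_preimage, Set.mem_ofPred_eq, shift_cons]
        rfl
    _ = _ := by simp

/-- With `n` the first nonzero digit, the series is `point y n` times `d n` plus `y (n + 1)` times a
quantity depending only on later errors. Slow decay bounds the first factor below, and the law of `y
(n + 1)` handles the second. -/
lemma errorSeqLaw_series_le {θ C : ℝ} (hθ : 0 < θ)
    (hC : ∀ w r : ℝ, 0 ≤ r → errorLaw θ {u | |1 + u * w| ≤ r} ≤ ENNReal.ofReal (C * r))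
    {c ρ r : ℝ} (hc : 0 < c) (hρ : 0 < ρ) (hr : 0 ≤ r) {d : ℕ → ℝ} (hd : ∀ i, |d i| ≤ 1)
    {n : ℕ} (hn : |d n| = 1) (h0 : ∀ i < n, d i = 0) :
    errorSeqLaw θ ({y | |series d y| ≤ r} ∩ slowDecay c ρ) ≤
      ENNReal.ofReal (C * (r / (c * ρ ^ (n + 1)))) := by
  have hcρ : 0 < c * ρ ^ (n + 1) := by positivity
  set e := shift (n + 1) d with he
  have he1 : ∀ i, |e i| ≤ 1 := fun i => hd _
  set B : Set (ℕ → ℝ) := {y | |1 + y 0 * (d n * (e 0 + series (shift 1 e) (shift 1 y)))| ≤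
    r / (c * ρ ^ (n + 1))} with hB
  have hBm : MeasurableSet B := by
    have := (measurable_series.comp (measurable_const (a := shift 1 e).prodMk measurable_id)).comp
      (measurable_shift (α := ℝ) 1)
    simp only [Function.comp_def, id] at this
    exact measurableSet_le (by fun_prop) measurable_const
  have hle : errorSeqLaw θ ({y | |series d y| ≤ r} ∩ slowDecay c ρ) ≤
      errorSeqLaw θ (shift (n + 1) ⁻¹' B) := by
    refine measure_mono_ae ?_
    filter_upwards [ae_isTypical θ] with y hy hyr
    obtain ⟨hyr, hyc⟩ := hyr
    have hs := hy.summable hθ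
    have hpos : ∀ i, 0 < shift (n + 1) y i := fun i => hy.pos _
    have h1 : |series d y| ≤ r := hyr
    rw [series_eq_point_mul hy.pos hs hd n h0,
      series_eq_point_mul hpos (summable_point_shift hy.pos hs n) he1 0 (by simp), abs_mul,
      abs_of_pos (point_pos hy.pos n)] at h1
    -- Multiplying by `d n = ±1` turns the leading digit into 1.
    have h2 : |d n + point (shift (n + 1) y) 0 *
        (e 0 + series (shift (0 + 1) e) (shift (0 + 1) (shift (n + 1) y)))| =
        |1 + shift (n + 1) y 0 *
          (d n * (e 0 + series (shift 1 e) (shift 1 (shift (n + 1) y))))| := by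
      have hdd : d n * d n = 1 := by rw [← abs_mul_abs_self, hn, one_mul]
      rw [← one_mul |1 + shift (n + 1) y 0 * _|, show (1 : ℝ) * |1 + shift (n + 1) y 0 * (d n * (e 0 +
          series (shift 1 e) (shift 1 (shift (n + 1) y))))| = |d n| * _ by rw [hn], ← abs_mul]
      congr 1
      simp only [point, zero_add, Finset.range_one, Finset.prod_singleton]
      linear_combination (-shift (n + 1) y 0 *
        (e 0 + series (shift 1 e) (shift 1 (shift (n + 1) y)))) * hdd
    rw [h2] at h1
    change |1 + shift (n + 1) y 0 *
      (d n * (e 0 + series (shift 1 e) (shift 1 (shift (n + 1) y))))| ≤ r / (c * ρ ^ (n + 1))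
    rw [le_div_iff₀ hcρ, mul_comm]
    exact (mul_le_mul_of_nonneg_right (hyc n) (abs_nonneg _)).trans h1
  refine hle.trans ?_
  rw [(measurePreserving_shift θ (n + 1)).measure_preimage hBm.nullMeasurableSet]
  exact errorSeqLaw_near_zero_le hC (by positivity) _ _ _

/-- `min 1 t ≤ t ^ s`: this interpolation turns the linear small-ball bound into exponent `s`. -/
lemma le_ofReal_rpow_of_le_one {x : ℝ≥0∞} (hx : x ≤ 1) {t s : ℝ} (ht : 0 ≤ t) (hs0 : 0 < s)
    (hs : s ≤ 1) (hxt : x ≤ ENNReal.ofReal t) : x ≤ ENNReal.ofReal (t ^ s) := by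
  rcases le_total t 1 with h | h
  · exact hxt.trans (ENNReal.ofReal_le_ofReal (Real.self_le_rpow_of_le_one ht h hs))
  · refine hx.trans ?_
    rw [ENNReal.one_le_ofReal]
    exact Real.one_le_rpow h hs0.le

open Classical in
/-- The indices in `I` below `n`. -/
def indicesBelow (I : Set ℕ) (n : ℕ) : Finset ℕ := (Finset.range n).filter (· ∈ I)

lemma mem_indicesBelow {I : Set ℕ} {n i : ℕ} : i ∈ indicesBelow I n ↔ i < n ∧ i ∈ I := by
  simp [indicesBelow]

/-- The pairs of digit sequences that agree at the indices in `I` below `n`. -/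
def agree (I : Set ℕ) (n : ℕ) : Set ((ℕ → ℝ) × (ℕ → ℝ)) :=
  {p | ∀ i ∈ indicesBelow I n, p.2 i = p.1 i}

lemma measurableSet_agreeBelow (I : Set ℕ) (n : ℕ) : MeasurableSet (agree I n) :=
  measurableSet_agree _

lemma lintegral_pairMass_le {θ : ℝ} (hθ : 0 < θ) (I : Set ℕ) {c ρ s B q : ℝ} (hc : 0 < c)
    (hρ : 0 < ρ) (hρ1 : ρ ≤ 1) (hs0 : 0 < s) (hs : s ≤ 1) (hB : 0 < B) (hq : 0 < q)
    (hqρ : q < ρ ^ s) (hI : ∀ n, (2⁻¹ : ℝ) ^ (indicesBelow I n).card ≤ B * q ^ n) :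
    ∃ K : ℝ, ∀ r : ℝ, 0 ≤ r →
      ∫⁻ y in slowDecay c ρ, pairMass (partialLaw I y) r ∂(errorSeqLaw θ) ≤
        ENNReal.ofReal (K * r ^ s) := by
  obtain ⟨C, hC0, hC⟩ := exists_errorLaw_le hθ
  have hq1 : q < 1 := hqρ.trans_le (Real.rpow_le_one hρ.le hρ1 hs0.le)
  have hgeo : Summable fun n : ℕ => (q / ρ ^ s) ^ n :=
    summable_geometric_of_lt_one (by positivity) ((div_lt_one (by positivity)).2 hqρ)
  -- The `n`-th term pairs the agreement probability `B * q ^ n` with `(C r / (c ρ ^ (n + 1))) ^ s`;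
  -- the series is geometric with ratio `q / ρ ^ s < 1`.
  refine ⟨∑' n : ℕ, (B * (C / (c * ρ)) ^ s) * (q / ρ ^ s) ^ n, fun r hr => ?_⟩
  have hagree : ∀ n, (coinSeqLaw.prod coinSeqLaw) (agree I n) ≤ ENNReal.ofReal (B * q ^ n) := by
    intro n
    rw [agree, coinSeqLaw_prod_agree]
    refine le_trans ?_ (ENNReal.ofReal_le_ofReal (hI n))
    rw [ENNReal.ofReal_pow (by norm_num), ENNReal.ofReal_inv_of_pos two_pos]
    simp
  -- Almost surely the two digit sequences disagree somewhere on `I`, so a first disagreement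
  -- exists.
  have hinf : (coinSeqLaw.prod coinSeqLaw) (⋂ n, agree I n) = 0 := by
    have h1 : Tendsto (fun n : ℕ => ENNReal.ofReal (B * q ^ n)) atTop (𝓝 0) := by
      have h2 := (tendsto_pow_atTop_nhds_zero_of_lt_one hq.le hq1).const_mul B
      rw [mul_zero] at h2
      simpa [Function.comp_def] using (ENNReal.continuous_ofReal.tendsto _).comp h2
    exact le_zero_iff.1 (ge_of_tendsto' h1 fun n =>
      (measure_mono (Set.iInter_subset _ n)).trans (hagree n))
  set b : ℕ → ℝ≥0∞ := fun n => ENNReal.ofReal ((C * (r / (c * ρ ^ (n + 1)))) ^ s) with hb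
  set S := {q : (ℕ → ℝ) × ((ℕ → ℝ) × (ℕ → ℝ)) |
      |series (I.indicator q.2.1) q.1 - series (I.indicator q.2.2) q.1| ≤ r} with hS
  have hSm : MeasurableSet S := measurableSet_closePair I r
  -- For a fixed pair of digit sequences only the errors are random. The bound at the first
  -- disagreement `n` is a single term of the sum, since the pair agrees below `n`.
  have hφ : ∀ᵐ p ∂(coinSeqLaw.prod coinSeqLaw),
      ((errorSeqLaw θ).restrict (slowDecay c ρ)) ((fun y => (y, p)) ⁻¹' S) ≤
        ∑' n, b n * (agree I n).indicator 1 p := by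
    have hdig1 := Measure.quasiMeasurePreserving_fst (μ := coinSeqLaw) (ν := coinSeqLaw)
      |>.ae ae_coinSeqLaw
    have hdig2 := Measure.quasiMeasurePreserving_snd (μ := coinSeqLaw) (ν := coinSeqLaw)
      |>.ae ae_coinSeqLaw
    filter_upwards [hdig1, hdig2, measure_eq_zero_iff_ae_notMem.1 hinf] with p h1 h2 h3
    set d : ℕ → ℝ := fun i => I.indicator p.1 i - I.indicator p.2 i with hd
    have hd1 : ∀ i, |d i| ≤ 1 := fun i => by
      by_cases hi : i ∈ I
      · rcases h1 i with h | h <;> rcases h2 i with h' | h' <;> simp [hd, hi, h, h']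
      · simp [hd, hi]
    have hd2 : ∀ i, d i ≠ 0 → |d i| = 1 := fun i h0 => by
      by_cases hi : i ∈ I
      · rcases h1 i with h | h <;> rcases h2 i with h' | h' <;> simp [hd, hi, h, h'] at h0 ⊢
      · simp [hd, hi] at h0
    have hex : ∃ n, d n ≠ 0 := by
      by_contra! hall
      refine h3 (Set.mem_iInter.2 fun n i hi => ?_)
      have := hall i
      simp only [hd, Set.indicator_of_mem (mem_indicesBelow.1 hi).2] at this
      linarith
    classical
    set n := Nat.find hex
    have hn : d n ≠ 0 := Nat.find_spec hex
    have hlt : ∀ i < n, d i = 0 := fun i hi => not_not.1 (Nat.find_min hex hi)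
    have hmem : p ∈ agree I n := fun i hi => by
      obtain ⟨hin, hiI⟩ := mem_indicesBelow.1 hi
      have := hlt i hin
      simp only [hd, Set.indicator_of_mem hiI] at this
      linarith
    have hSp : MeasurableSet ((fun y => (y, p)) ⁻¹' S) := measurable_prodMk_right hSm
    have hbn : ((errorSeqLaw θ).restrict (slowDecay c ρ)) ((fun y => (y, p)) ⁻¹' S) ≤ b n := by
      refine le_ofReal_rpow_of_le_one ?_ (by positivity) hs0 hs ?_
      · exact (Measure.restrict_apply_le _ _).trans prob_le_one
      · rw [Measure.restrict_apply hSp]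
        refine le_trans (measure_mono_ae ?_)
          (errorSeqLaw_series_le hθ hC hc hρ hr hd1 (hd2 n hn) hlt)
        filter_upwards [ae_isTypical θ] with y hy hyS
        refine ⟨?_, hyS.2⟩
        have hyr : |series (I.indicator p.1) y - series (I.indicator p.2) y| ≤ r := hyS.1
        have hsum : ∀ a : ℕ → ℝ, (∀ i, a i = 0 ∨ a i = 1) →
            Summable fun i => I.indicator a i * point y i := fun a ha =>
          summable_mul_point hy.pos (hy.summable hθ) fun i => by
            by_cases hi : i ∈ I
            · rw [Set.indicator_of_mem hi]; exact abs_le_one_of_digit (ha i)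
            · simp [hi]
        have : series d y = series (I.indicator p.1) y - series (I.indicator p.2) y := by
          rw [series, series, series, ← (hsum _ h1).tsum_sub (hsum _ h2)]
          exact tsum_congr fun i => by simp only [hd]; ring
        change |series d y| ≤ r
        rwa [this]
    refine hbn.trans ?_
    have := ENNReal.le_tsum (f := fun n => b n * (agree I n).indicator 1 p) n
    simpa [Set.indicator_of_mem hmem] using this
  calc ∫⁻ y in slowDecay c ρ, pairMass (partialLaw I y) r ∂(errorSeqLaw θ)
      = (((errorSeqLaw θ).restrict (slowDecay c ρ)).prod (coinSeqLaw.prod coinSeqLaw)) S := by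
        simp_rw [pairMass_partialLaw]
        rw [Measure.prod_apply hSm]
    _ = ∫⁻ p, ((errorSeqLaw θ).restrict (slowDecay c ρ)) ((fun y => (y, p)) ⁻¹' S)
          ∂(coinSeqLaw.prod coinSeqLaw) := Measure.prod_apply_symm hSm
    _ ≤ ∫⁻ p, ∑' n, b n * (agree I n).indicator 1 p ∂(coinSeqLaw.prod coinSeqLaw) :=
        lintegral_mono_ae hφ
    _ = ∑' n, b n * (coinSeqLaw.prod coinSeqLaw) (agree I n) := by
        have hbm : ∀ n, Measurable fun p : (ℕ → ℝ) × (ℕ → ℝ) =>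
            b n * (agree I n).indicator (1 : (ℕ → ℝ) × (ℕ → ℝ) → ℝ≥0∞) p := fun n =>
          measurable_const.mul (measurable_one.indicator (measurableSet_agreeBelow I n))
        rw [lintegral_tsum fun n => (hbm n).aemeasurable]
        refine tsum_congr fun n => ?_
        rw [lintegral_const_mul _ (measurable_one.indicator (measurableSet_agreeBelow I n)),
          lintegral_indicator_one (measurableSet_agreeBelow I n)]
    _ ≤ ∑' n, ENNReal.ofReal (((B * (C / (c * ρ)) ^ s) * (q / ρ ^ s) ^ n) * r ^ s) := by
        refine ENNReal.tsum_le_tsum fun n => ?_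
        refine (mul_le_mul_right (hagree n) _).trans_eq ?_
        rw [hb, ← ENNReal.ofReal_mul (by positivity)]
        congr 1
        rw [show C * (r / (c * ρ ^ (n + 1))) = C / (c * ρ) * r * (ρ ^ n)⁻¹ by
            rw [pow_succ]; field_simp,
          Real.mul_rpow (by positivity) (by positivity), Real.mul_rpow (by positivity) hr,
          Real.inv_rpow (by positivity), ← Real.rpow_natCast ρ n, ← Real.rpow_mul hρ.le, mul_comm
          (n : ℝ) s, Real.rpow_mul hρ.le, Real.rpow_natCast, div_pow]
        ring
    _ = _ := by
        rw [← ENNReal.ofReal_tsum_of_nonneg (fun n => by positivity)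
          ((hgeo.mul_left _).mul_right _), tsum_mul_right]

/-- Almost every sequence is slowly decaying, for a rational constant. -/
lemma ae_of_ae_slowDecay {θ ρ : ℝ} (hρ : 0 < ρ) (hlt : Real.log ρ < -θ⁻¹) {p : (ℕ → ℝ) → Prop}
    (h : ∀ c > 0, ∀ᵐ y ∂(errorSeqLaw θ), y ∈ slowDecay c ρ → p y) :
    ∀ᵐ y ∂(errorSeqLaw θ), p y := by
  have h' : ∀ m : ℕ, ∀ᵐ y ∂(errorSeqLaw θ), y ∈ slowDecay (1 / ((m : ℝ) + 1)) ρ → p y :=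
    fun m => h _ (by positivity)
  filter_upwards [ae_all_iff.2 h', ae_isTypical θ] with y hy hty
  obtain ⟨c, hc, hb⟩ := hty.exists_mul_pow_le_point hρ hlt
  obtain ⟨m, hm⟩ := exists_nat_one_div_lt hc
  exact hy m fun n => (mul_le_mul_of_nonneg_right hm.le (by positivity)).trans (hb n)

lemma ae_liminf_pairMass_ne_top {θ : ℝ} (hθ : 0 < θ) (I : Set ℕ) {ρ B q : ℝ}
    (hρ : 0 < ρ) (hρ1 : ρ ≤ 1) (hlt : Real.log ρ < -θ⁻¹) (hB : 0 < B) (hq : 0 < q)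
    (hqρ : q < ρ) (hI : ∀ n, (2⁻¹ : ℝ) ^ (indicesBelow I n).card ≤ B * q ^ n) :
    ∀ᵐ y ∂(errorSeqLaw θ),
      liminf (fun k : ℕ => 2 ^ k * pairMass (partialLaw I y) ((1 / 2) ^ k)) atTop ≠ ∞ := by
  refine ae_of_ae_slowDecay hρ hlt fun c hc => ?_
  obtain ⟨K, hK⟩ := lintegral_pairMass_le hθ I hc hρ hρ1 one_pos le_rfl hB hq
    (by rwa [Real.rpow_one]) hI
  rw [← ae_restrict_iff' (measurableSet_slowDecay c ρ)]
  have hm : ∀ k : ℕ, Measurable fun y => 2 ^ k * pairMass (partialLaw I y) ((1 / 2) ^ k) :=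
    fun k => (measurable_pairMass_partialLaw I _).const_mul _
  refine (ae_lt_top (Measurable.liminf hm) ?_).mono fun y hy => hy.ne
  refine ne_top_of_le_ne_top (ENNReal.ofReal_ne_top (r := K))
    ((lintegral_liminf_le hm).trans ?_)
  refine (liminf_le_liminf (Eventually.of_forall fun k => ?_)).trans_eq
    (liminf_const (f := (atTop : Filter ℕ)) (ENNReal.ofReal K))
  rw [lintegral_const_mul _ (measurable_pairMass_partialLaw I _)]
  refine (mul_le_mul_right (hK _ (by positivity)) _).trans_eq ?_
  have h2 : (2 : ℝ≥0∞) ^ k = ENNReal.ofReal (2 ^ k) := by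
    rw [ENNReal.ofReal_pow two_pos.le]; simp
  rw [h2, ← ENNReal.ofReal_mul (by positivity), Real.rpow_one]
  congr 1
  rw [mul_left_comm, ← mul_pow]
  norm_num

lemma ae_tsum_pairMass_ne_top {θ : ℝ} (hθ : 0 < θ) (I : Set ℕ) {ρ B q s t : ℝ}
    (hρ : 0 < ρ) (hρ1 : ρ ≤ 1) (hlt : Real.log ρ < -θ⁻¹) (hB : 0 < B) (hq : 0 < q)
    (hs0 : 0 < s) (hs : s ≤ 1) (hts : t < s) (hqρ : q < ρ ^ s)
    (hI : ∀ n, (2⁻¹ : ℝ) ^ (indicesBelow I n).card ≤ B * q ^ n) :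
    ∀ᵐ y ∂(errorSeqLaw θ),
      ∑' k : ℕ, pairMass (partialLaw I y) ((1 / 2) ^ k) / ((1 / 2) ^ k) ^ t ≠ ∞ := by
  refine ae_of_ae_slowDecay hρ hlt fun c hc => ?_
  obtain ⟨K, hK⟩ := lintegral_pairMass_le hθ I hc hρ hρ1 hs0 hs hB hq hqρ hI
  rw [← ae_restrict_iff' (measurableSet_slowDecay c ρ)]
  have hm : ∀ k : ℕ, Measurable fun y =>
      pairMass (partialLaw I y) ((1 / 2) ^ k) / ((1 / 2 : ℝ≥0∞) ^ k) ^ t :=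
    fun k => (measurable_pairMass_partialLaw I _).div_const _
  refine (ae_lt_top (Measurable.tsum hm) ?_).mono fun y hy => hy.ne
  rw [lintegral_tsum fun k => (hm k).aemeasurable]
  have hle : ∀ k : ℕ, ∫⁻ y in slowDecay c ρ,
      pairMass (partialLaw I y) ((1 / 2) ^ k) / ((1 / 2 : ℝ≥0∞) ^ k) ^ t ∂(errorSeqLaw θ) ≤
      -- `K` carries no sign information; `max K 0` keeps the geometric majorant nonnegative.
      ENNReal.ofReal (max K 0 * ((1 / 2 : ℝ) ^ (s - t)) ^ k) := fun k => by
    simp_rw [div_eq_mul_inv _ (((1 / 2 : ℝ≥0∞) ^ k) ^ t)]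
    rw [lintegral_mul_const _ (measurable_pairMass_partialLaw I _)]
    refine (mul_le_mul_left (hK _ (by positivity)) _).trans ?_
    have h2 : (((1 / 2 : ℝ≥0∞) ^ k) ^ t)⁻¹ = ENNReal.ofReal ((((1 / 2 : ℝ) ^ k) ^ t)⁻¹) := by
      rw [ENNReal.ofReal_inv_of_pos (by positivity), ← ENNReal.ofReal_rpow_of_pos (by positivity),
        ENNReal.ofReal_pow (by positivity), one_div (2 : ℝ), ENNReal.ofReal_inv_of_pos two_pos]
      simp
    rw [h2, ← ENNReal.ofReal_mul' (by positivity)]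
    refine ENNReal.ofReal_le_ofReal ?_
    rw [mul_assoc, ← Real.rpow_neg (by positivity), ← Real.rpow_add (by positivity),
      ← Real.rpow_natCast (1 / 2) k, ← Real.rpow_mul (by positivity), mul_comm (k : ℝ),
      Real.rpow_mul (by positivity), Real.rpow_natCast, ← sub_eq_add_neg]
    gcongr
    exact le_max_left _ _
  refine ne_top_of_le_ne_top ?_ (ENNReal.tsum_le_tsum hle)
  have hg := (summable_geometric_of_lt_one (r := (1 / 2 : ℝ) ^ (s - t)) (by positivity)
    (Real.rpow_lt_one (by norm_num) (by norm_num) (by linarith))).mul_left (max K 0)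
  rw [← ENNReal.ofReal_tsum_of_nonneg (fun k => by positivity) hg]
  exact ENNReal.ofReal_ne_top

/-! ### Splitting the digits between two index sets -/

section Mixing

open Classical in
/-- The sequence with terms from `p.1` at the indices in `I`, and from `p.2` at the others. -/
def mix (I : Set ℕ) (p : (ℕ → ℝ) × (ℕ → ℝ)) : ℕ → ℝ := fun i => if i ∈ I then p.1 i else p.2 i

lemma measurable_mix (I : Set ℕ) : Measurable (mix I) := by
  refine measurable_pi_lambda _ fun i => ?_
  by_cases hi : i ∈ I
  · simp only [mix, hi, if_true]
    exact (measurable_pi_apply i).comp measurable_fst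
  · simp only [mix, hi, if_false]
    exact (measurable_pi_apply i).comp measurable_snd

lemma measurePreserving_mix (μ : Measure ℝ) [IsProbabilityMeasure μ] (I : Set ℕ) :
    MeasurePreserving (mix I)
      ((Measure.infinitePi fun _ : ℕ => μ).prod (Measure.infinitePi fun _ : ℕ => μ))
      (Measure.infinitePi fun _ : ℕ => μ) := by
  classical
  refine ⟨measurable_mix I, Measure.eq_infinitePi _ fun s t ht => ?_⟩
  have hpre : mix I ⁻¹' Set.pi s t =
      Set.pi (s.filter (· ∈ I)) t ×ˢ Set.pi (s.filter (· ∉ I)) t := by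
    ext p
    simp only [Set.mem_preimage, Set.mem_pi, Set.mem_prod, Finset.mem_coe, Finset.mem_filter, mix]
    constructor
    · exact fun h => ⟨fun i hi => by simpa [hi.2] using h i hi.1,
        fun i hi => by simpa [hi.2] using h i hi.1⟩
    · rintro ⟨h1, h2⟩ i hi
      split_ifs with hI
      exacts [h1 i ⟨hi, hI⟩, h2 i ⟨hi, hI⟩]
  rw [Measure.map_apply (measurable_mix I)
    (MeasurableSet.pi s.countable_toSet fun i _ => ht i), hpre, Measure.prod_prod,
    Measure.infinitePi_pi _ fun i _ => ht i, Measure.infinitePi_pi _ fun i _ => ht i,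
    Finset.prod_filter_mul_prod_filter_not]

lemma measurable_series_left (I : Set ℕ) (y : ℕ → ℝ) :
    Measurable fun a => series (I.indicator a) y :=
  (measurable_partialSeries I).comp (measurable_id.prodMk measurable_const)

lemma summable_indicator_mul_point {y : ℕ → ℝ} (hy : ∀ i, 0 < y i) (hs : Summable (point y))
    (I : Set ℕ) {a : ℕ → ℝ} (ha : ∀ i, a i = 0 ∨ a i = 1) :
    Summable fun i => I.indicator a i * point y i :=
  summable_mul_point hy hs fun i => by
    by_cases hi : i ∈ I
    · rw [Set.indicator_of_mem hi]; exact abs_le_one_of_digit (ha i)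
    · simp [hi]

/-- Coins on `I` and on its complement are independent: drawing them from two separate coin
sequences does not change the law of the total sum. -/
lemma partialLaw_univ_eq_conv {y : ℕ → ℝ} (hy : ∀ i, 0 < y i) (hs : Summable (point y))
    (I : Set ℕ) : partialLaw Set.univ y = partialLaw I y ∗ partialLaw Iᶜ y := by
  have hdig1 := Measure.quasiMeasurePreserving_fst (μ := coinSeqLaw) (ν := coinSeqLaw)
    |>.ae ae_coinSeqLaw
  have hdig2 := Measure.quasiMeasurePreserving_snd (μ := coinSeqLaw) (ν := coinSeqLaw)
    |>.ae ae_coinSeqLaw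
  have hmix : MeasurePreserving (mix I) (coinSeqLaw.prod coinSeqLaw) coinSeqLaw :=
    measurePreserving_mix coinLaw I
  have hl : partialLaw Set.univ y = (coinSeqLaw.prod coinSeqLaw).map
      ((fun a => series (Set.univ.indicator a) y) ∘ mix I) := by
    rw [← Measure.map_map (measurable_series_left _ y) (measurable_mix I),
      hmix.map_eq, partialLaw]
  rw [hl, Measure.conv, partialLaw, partialLaw,
    Measure.map_prod_map _ _ (measurable_series_left I y) (measurable_series_left Iᶜ y),
    Measure.map_map (by fun_prop)
      ((measurable_series_left I y).prodMap (measurable_series_left Iᶜ y))]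
  refine Measure.map_congr ?_
  filter_upwards [hdig1, hdig2] with p h1 h2
  simp only [Function.comp, Set.indicator_univ, Prod.map]
  rw [series, series, series, ← (summable_indicator_mul_point hy hs I h1).tsum_add
    (summable_indicator_mul_point hy hs Iᶜ h2)]
  refine tsum_congr fun i => ?_
  by_cases hi : i ∈ I <;> simp [mix, hi]

end Mixing

/-! ### Supports of the laws -/

section Support

variable {y : ℕ → ℝ}

lemma partialLaw_univ_digitSums (hy : ∀ i, 0 < y i) (hs : Summable (point y)) :
    digitSums y ∈ ae (partialLaw Set.univ y) := by
  have : ∀ᵐ x ∂(partialLaw Set.univ y), x ∈ digitSums y := by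
    rw [partialLaw, ae_map_iff (p := (· ∈ digitSums y)) (measurable_series_left _ y).aemeasurable
      (isCompact_digitSums hy hs).measurableSet]
    filter_upwards [ae_coinSeqLaw] with a ha
    rw [Set.indicator_univ]
    exact (mem_digitSums_iff hy hs).2 ⟨a, ha, rfl⟩
  exact this

lemma support_partialLaw_univ (hy : ∀ i, 0 < y i) (hs : Summable (point y)) :
    (partialLaw Set.univ y).support = digitSums y := by
  refine Set.Subset.antisymm (Measure.support_subset_of_isClosed
    (isCompact_digitSums hy hs).isClosed (partialLaw_univ_digitSums hy hs)) ?_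
  intro x hx
  obtain ⟨b, hb, rfl⟩ := (mem_digitSums_iff hy hs).1 hx
  rw [nhds_basis_ball.mem_measureSupport]
  intro ε hε
  -- Sums that share their first `n` digits differ by at most twice the tail, and sharing them has
  -- probability `2⁻¹ ^ n > 0`.
  obtain ⟨n, hn⟩ := ((tendsto_tail y).eventually_lt_const (half_pos hε)).exists
  rw [partialLaw, Measure.map_apply (measurable_series_left _ y) measurableSet_ball]
  have hpos : 0 < coinSeqLaw {a | ∀ i ∈ Finset.range n, a i = b i} := by
    rw [coinSeqLaw_cylinder _ hb]
    exact ENNReal.pow_pos (by simp) _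
  refine hpos.trans_le (measure_mono_ae ?_)
  filter_upwards [ae_coinSeqLaw] with a ha hab
  have ha1 : ∀ i, |a i| ≤ 1 := fun i => abs_le_one_of_digit (ha i)
  have hb1 : ∀ i, |b i| ≤ 1 := fun i => abs_le_one_of_digit (hb i)
  change series (Set.univ.indicator a) y ∈ ball (series b y) ε
  rw [Set.indicator_univ, mem_ball, Real.dist_eq, series_eq_sum_add hy hs ha1 n,
    series_eq_sum_add hy hs hb1 n, Finset.sum_congr rfl fun i hi => by rw [hab i hi],
    add_sub_add_left_eq_sub]
  have h1 := abs_tsum_digits_le_tail hy hs ha1 n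
  have h2 := abs_tsum_digits_le_tail hy hs hb1 n
  exact (abs_sub _ _).trans_lt (by linarith)

lemma mem_support_of_isDensity {ν : Measure ℝ} {h : ℝ → ℝ} (hc : Continuous h)
    (hd : IsDensity ν h) {x : ℝ} (hx : 0 < h x) : x ∈ ν.support := by
  rw [Measure.mem_support_iff_forall]
  intro U hU
  refine pos_iff_ne_zero.2 fun h0 => ?_
  rw [hd.2, withDensity_apply_eq_zero' hc.measurable.ennreal_ofReal.aemeasurable] at h0
  have hV : {x | ENNReal.ofReal (h x) ≠ 0} ∩ U ∈ 𝓝 x := by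
    refine inter_mem ?_ hU
    filter_upwards [hc.continuousAt.eventually (lt_mem_nhds hx)] with z hz
    simpa using hz
  exact (Measure.measure_pos_of_mem_nhds volume hV).ne' h0

lemma exists_Icc_subset_support {ν : Measure ℝ} (hν : ν ≠ 0) {h : ℝ → ℝ} (hc : Continuous h)
    (hd : IsDensity ν h) : ∃ a b : ℝ, a < b ∧ Set.Icc a b ⊆ ν.support := by
  obtain ⟨x, hx⟩ : ∃ x, 0 < h x := by
    by_contra! hle
    apply hν
    rw [hd.2]
    simp [ENNReal.ofReal_of_nonpos (hle _)]
  obtain ⟨ε, hε, hb⟩ := Metric.mem_nhds_iff.1 (hc.continuousAt.eventually (lt_mem_nhds hx))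
  refine ⟨x, x + ε / 2, by linarith, fun z hz => mem_support_of_isDensity hc hd (hb ?_)⟩
  rw [mem_ball, Real.dist_eq, abs_of_nonneg (by linarith [hz.1])]
  linarith [hz.2]

lemma volume_support_pos {ν : Measure ℝ} (hν : ν ≠ 0) (h : ν ≪ volume) :
    0 < volume ν.support := by
  refine pos_iff_ne_zero.2 fun h0 => hν ?_
  have h1 : ν ν.supportᶜ = 0 := Measure.support_mem_ae
  rw [← Measure.measure_univ_eq_zero, ← Set.union_compl_self ν.support]
  exact measure_union_null (h h0) h1

lemma measureDimH_le_dimH_support (ν : Measure ℝ) : measureDimH ν ≤ dimH ν.support :=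
  iInf₂_le _ (Measure.support_mem_ae : ν.support ∈ ae ν)

end Support

/-! ### Counting even and odd indices -/

section Counting

lemma card_indicesBelow_univ (n : ℕ) : (indicesBelow Set.univ n).card = n := by
  simp [indicesBelow]

lemma inv_two_pow_card_univ_le (n : ℕ) :
    (2⁻¹ : ℝ) ^ (indicesBelow Set.univ n).card ≤ 1 * 2⁻¹ ^ n := by
  rw [card_indicesBelow_univ, one_mul]

lemma indicesBelow_succ_of_mem {I : Set ℕ} {n : ℕ} (h : n ∈ I) :
    (indicesBelow I (n + 1)).card = (indicesBelow I n).card + 1 := by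
  classical
  simp only [indicesBelow]
  rw [Finset.range_add_one, Finset.filter_insert, if_pos h, Finset.card_insert_of_notMem (by simp)]

lemma indicesBelow_succ_of_notMem {I : Set ℕ} {n : ℕ} (h : n ∉ I) :
    (indicesBelow I (n + 1)).card = (indicesBelow I n).card := by
  classical
  simp only [indicesBelow]
  rw [Finset.range_add_one, Finset.filter_insert, if_neg h]

lemma card_indicesBelow_even (n : ℕ) : (indicesBelow {i | Even i} n).card = (n + 1) / 2 := by
  induction n with
  | zero => simp [indicesBelow]
  | succ n ih =>
    by_cases h : Even n
    · rw [indicesBelow_succ_of_mem h, ih]; obtain ⟨k, rfl⟩ := h; omega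
    · rw [indicesBelow_succ_of_notMem h, ih]
      obtain ⟨k, rfl⟩ := Nat.not_even_iff_odd.1 h; omega

lemma card_indicesBelow_odd (n : ℕ) : (indicesBelow {i | Even i}ᶜ n).card = n / 2 := by
  induction n with
  | zero => simp [indicesBelow]
  | succ n ih =>
    by_cases h : Even n
    · rw [indicesBelow_succ_of_notMem (by simpa using h), ih]; obtain ⟨k, rfl⟩ := h; omega
    · rw [indicesBelow_succ_of_mem h, ih]
      obtain ⟨k, rfl⟩ := Nat.not_even_iff_odd.1 h; omega

lemma inv_two_pow_le_of_le {n m : ℕ} (h : n ≤ 2 * m + 1) :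
    (2⁻¹ : ℝ) ^ m ≤ (√2⁻¹)⁻¹ * √2⁻¹ ^ n := by
  have h0 : 0 < √(2⁻¹ : ℝ) := by positivity
  have h1 : √(2⁻¹ : ℝ) ≤ 1 := Real.sqrt_le_one.2 (by norm_num)
  rw [le_inv_mul_iff₀ h0]
  calc √(2⁻¹ : ℝ) * 2⁻¹ ^ m = √2⁻¹ ^ (2 * m + 1) := by
        rw [pow_succ, pow_mul, Real.sq_sqrt (by norm_num), mul_comm]
    _ ≤ _ := pow_le_pow_of_le_one h0.le h1 h

end Counting

/-! ### The density and dimension regimes -/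

section Phases

variable {θ : ℝ}

lemma inv_lt_log_two (hθ : 0 < θ) (h : 1 / Real.log 2 < θ) : θ⁻¹ < Real.log 2 := by
  have hl2 : 0 < Real.log 2 := Real.log_pos one_lt_two
  rw [inv_lt_comm₀ hθ hl2]
  simpa using h

lemma ae_exists_memLp_two_isDensity (hθ : 0 < θ) (h : 1 / Real.log 2 < θ) :
    ∀ᵐ y ∂(errorSeqLaw θ), partialLaw Set.univ y ≪ volume ∧
      ∃ f : ℝ → ℝ, MemLp f 2 volume ∧ IsDensity (partialLaw Set.univ y) f := by
  have hlt := inv_lt_log_two hθ h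
  -- The decay rate `ρ = exp l` is chosen with `1 / 2 < ρ < exp (-θ⁻¹)`.
  obtain ⟨l, hl1, hl2⟩ := exists_between (neg_lt_neg hlt)
  have hl0 : l < 0 := hl2.trans (neg_lt_zero.2 (inv_pos.2 hθ))
  have hq : (2⁻¹ : ℝ) < Real.exp l := by
    rw [← Real.exp_log (show (0 : ℝ) < 2⁻¹ by norm_num), Real.exp_lt_exp, Real.log_inv]
    exact hl1
  filter_upwards [ae_liminf_pairMass_ne_top hθ Set.univ (Real.exp_pos l)
    (Real.exp_lt_one_iff.2 hl0).le (by rwa [Real.log_exp]) one_pos (by norm_num) hq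
    inv_two_pow_card_univ_le] with y hy
  exact exists_memLp_two_isDensity _ hy

lemma ae_exists_continuous_isDensity (hθ : 0 < θ) (h : 2 / Real.log 2 < θ) :
    ∀ᵐ y ∂(errorSeqLaw θ), partialLaw Set.univ y ≪ volume ∧
      ∃ f : ℝ → ℝ, Continuous f ∧ IsDensity (partialLaw Set.univ y) f := by
  have hl2 : 0 < Real.log 2 := Real.log_pos one_lt_two
  have hlt : θ⁻¹ < Real.log 2 / 2 := by
    rw [inv_lt_comm₀ hθ (by positivity), inv_div]
    exact h
  obtain ⟨l, hl1, hl2⟩ := exists_between (neg_lt_neg hlt)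
  have hl0 : l < 0 := hl2.trans (neg_lt_zero.2 (inv_pos.2 hθ))
  have hq0 : 0 < √(2⁻¹ : ℝ) := by positivity
  have hq : √(2⁻¹ : ℝ) < Real.exp l := by
    rw [← Real.exp_log hq0, Real.exp_lt_exp, Real.log_sqrt (by norm_num), Real.log_inv, neg_div]
    exact hl1
  -- Using only half of the digits replaces the agreement rate `1 / 2` by its square root, hence the
  -- doubled threshold for `θ`.
  have key : ∀ I : Set ℕ, (∀ n, n ≤ 2 * (indicesBelow I n).card + 1) →
      ∀ᵐ y ∂(errorSeqLaw θ), ∃ f : ℝ → ℝ, MemLp f 2 volume ∧ IsDensity (partialLaw I y) f := by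
    intro I hI
    filter_upwards [ae_liminf_pairMass_ne_top hθ I (Real.exp_pos l)
      (Real.exp_lt_one_iff.2 hl0).le (by rwa [Real.log_exp]) (inv_pos.2 hq0) hq0 hq
      fun n => inv_two_pow_le_of_le (hI n)] with y hy
    exact (exists_memLp_two_isDensity _ hy).2
  filter_upwards [ae_isTypical θ, key {i | Even i} fun n => by rw [card_indicesBelow_even]; omega,
    key {i | Even i}ᶜ fun n => by rw [card_indicesBelow_odd]; omega] with y hy ⟨f, hf, hfd⟩
    ⟨g, hg, hgd⟩
  obtain ⟨k, hk, hkd⟩ := exists_continuous_isDensity_conv hf hg hfd hgd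
  rw [← partialLaw_univ_eq_conv hy.pos (hy.summable hθ)] at hkd
  exact ⟨hkd.2 ▸ withDensity_absolutelyContinuous _ _, k, hk, hkd⟩

lemma ae_le_dimH (hθ : 0 < θ) (hle : θ * Real.log 2 ≤ 1) {t : NNReal} (ht0 : 0 < t)
    (ht : (t : ℝ) < θ * Real.log 2) : ∀ᵐ y ∂(errorSeqLaw θ),
      ∀ A : Set ℝ, partialLaw Set.univ y Aᶜ = 0 → (t : ℝ≥0∞) ≤ dimH A := by
  obtain ⟨s, hts, hs⟩ := exists_between ht
  have ht0' : (0 : ℝ) < t := ht0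
  have hs0 : 0 < s := ht0'.trans hts
  have hlt : θ⁻¹ < Real.log 2 / s := by
    rw [lt_div_iff₀ hs0, inv_mul_lt_iff₀ hθ]
    exact hs
  -- Here `ρ = exp l < exp (-θ⁻¹)` and `ρ ^ s > 1 / 2`, possible because `s < θ * log 2`. The gap
  -- between `t` and `s` makes the sum over dyadic scales converge.
  obtain ⟨l, hl1, hl2⟩ := exists_between (neg_lt_neg hlt)
  have hl0 : l < 0 := hl2.trans (neg_lt_zero.2 (inv_pos.2 hθ))
  have hq : (2⁻¹ : ℝ) < Real.exp l ^ s := by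
    rw [← Real.exp_mul, ← Real.exp_log (show (0 : ℝ) < 2⁻¹ by norm_num), Real.exp_lt_exp,
      Real.log_inv, ← div_lt_iff₀ hs0, neg_div]
    exact hl1
  filter_upwards [ae_tsum_pairMass_ne_top hθ Set.univ (Real.exp_pos l)
    (Real.exp_lt_one_iff.2 hl0).le (by rwa [Real.log_exp]) one_pos (by norm_num) hs0
    (hs.le.trans hle) hts hq inv_two_pow_card_univ_le] with y hy A hA
  exact le_dimH_of_measure_closedBall_le _ (IsProbabilityMeasure.ne_zero _) ht0
    (ae_exists_measure_closedBall_le _ _ hy) hA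

/-- Rational exponents below `θ * log 2` suffice, so a single null set of sequences serves for all
of them. -/
lemma ae_le_measureDimH (hθ : 0 < θ) (hle : θ * Real.log 2 ≤ 1) : ∀ᵐ y ∂(errorSeqLaw θ),
    ENNReal.ofReal (θ * Real.log 2) ≤ measureDimH (partialLaw Set.univ y) := by
  have h : ∀ q : ℚ, ∀ᵐ y ∂(errorSeqLaw θ), 0 < Real.toNNReal q → (q : ℝ) < θ * Real.log 2 →
      ∀ A : Set ℝ, partialLaw Set.univ y Aᶜ = 0 → ((Real.toNNReal q : NNReal) : ℝ≥0∞) ≤ dimH A := by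
    intro q
    rw [eventually_imp_distrib_left]
    intro h0
    rw [eventually_imp_distrib_left]
    intro h1
    refine ae_le_dimH hθ hle h0 ?_
    rwa [Real.coe_toNNReal _ (Real.toNNReal_pos.1 h0).le]
  filter_upwards [ae_all_iff.2 h] with y hy
  refine le_iInf₂ fun A hA => ?_
  by_contra! hlt
  obtain ⟨q, hq0, hq1, hq2⟩ := ENNReal.lt_iff_exists_rat_btwn.1 hlt
  have hpos : 0 < Real.toNNReal q := by
    have := zero_le.trans_lt hq1
    exact_mod_cast this
  refine absurd (hy q hpos ?_ A hA) (not_le.2 hq1)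
  rw [← ENNReal.ofReal, ENNReal.ofReal_lt_ofReal_iff_of_nonneg (by exact_mod_cast hq0)] at hq2
  exact hq2

end Phases

/-! ### Identification of the conditional law -/

section CondLaw

/-- The laws of the sums, as a kernel from the sequences of errors. -/
def sumKernel : Kernel (ℕ → ℝ) ℝ where
  toFun := partialLaw Set.univ
  measurable' := by
    refine Measure.measurable_of_measurable_coe _ fun s hs => ?_
    simp_rw [partialLaw, Measure.map_apply (measurable_series_left _ _) hs, Set.indicator_univ]
    exact measurable_measure_prodMk_left (s := (fun q : (ℕ → ℝ) × (ℕ → ℝ) => series q.2 q.1) ⁻¹' s)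
      ((measurable_series.comp measurable_swap) hs)

instance : IsMarkovKernel sumKernel :=
  ⟨fun y => inferInstanceAs (IsProbabilityMeasure (partialLaw Set.univ y))⟩

variable {Ω : Type*} [MeasurableSpace Ω] {P : Measure Ω} {θ : ℝ}
  {Y J : ℕ → Ω → ℝ}

lemma map_errors (hYm : ∀ i, Measurable (Y i)) (hYlaw : ∀ i, P.map (Y i) = errorLaw θ)
    (hYindep : iIndepFun Y P) : P.map (fun ω i => Y i ω) = errorSeqLaw θ := by
  rw [hYindep.map_fun_eq_infinitePi_map hYm, errorSeqLaw]
  simp_rw [hYlaw]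

lemma map_coins (hJm : ∀ i, Measurable (J i)) (hJlaw : ∀ i, P.map (J i) = coinLaw)
    (hJindep : iIndepFun J P) : P.map (fun ω i => J i ω) = coinSeqLaw := by
  rw [hJindep.map_fun_eq_infinitePi_map hJm, coinSeqLaw]
  simp_rw [hJlaw]

/-- Conditional distributions are almost surely unique, so it suffices that `sumKernel`
disintegrates the joint law of errors and sum; independence of errors and coins gives this by
Tonelli. -/
lemma condLaw_ae_eq [IsProbabilityMeasure P]
    (hYm : ∀ i, Measurable (Y i)) (hJm : ∀ i, Measurable (J i))
    (hYlaw : ∀ i, P.map (Y i) = errorLaw θ) (hJlaw : ∀ i, P.map (J i) = coinLaw)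
    (hYindep : iIndepFun Y P) (hJindep : iIndepFun J P)
    (hYJ : IndepFun (fun ω i => Y i ω) (fun ω i => J i ω) P) :
    ∀ᵐ y ∂(errorSeqLaw θ), condLaw P Y J y = partialLaw Set.univ y := by
  have hY : Measurable fun ω i => Y i ω := measurable_pi_lambda _ hYm
  have hJ : Measurable fun ω i => J i ω := measurable_pi_lambda _ hJm
  have hZ : Measurable (randomSum Y J) := measurable_series.comp (hJ.prodMk hY)
  rw [← map_errors hYm hYlaw hYindep]
  refine condDistrib_ae_eq_of_measure_eq_compProd (κ := sumKernel) _ hZ.aemeasurable ?_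
  have hjoint := (indepFun_iff_map_prod_eq_prod_map_map hY.aemeasurable hJ.aemeasurable).1 hYJ
  rw [map_coins hJm hJlaw hJindep] at hjoint
  have hg : Measurable fun p : (ℕ → ℝ) × (ℕ → ℝ) => (p.1, series p.2 p.1) :=
    measurable_fst.prodMk (measurable_series.comp measurable_swap)
  have hcomp : (fun ω => ((fun i => Y i ω), randomSum Y J ω)) =
      (fun p : (ℕ → ℝ) × (ℕ → ℝ) => (p.1, series p.2 p.1)) ∘ fun ω =>
        ((fun i => Y i ω), fun i => J i ω) := rfl
  rw [hcomp, ← Measure.map_map hg (hY.prodMk hJ), hjoint]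
  ext s hs
  have : IsProbabilityMeasure (P.map fun ω i => Y i ω) :=
    Measure.isProbabilityMeasure_map hY.aemeasurable
  rw [Measure.map_apply hg hs, Measure.prod_apply (hg hs), Measure.compProd_apply hs]
  refine lintegral_congr fun y => ?_
  change _ = partialLaw Set.univ y _
  rw [partialLaw, Measure.map_apply (measurable_series_left _ y) (measurable_prodMk_left hs)]
  simp_rw [Set.indicator_univ]
  rfl

end CondLaw

/-! ### Fluctuations of the logarithmic random walk -/

section Fluctuation

variable {θ : ℝ}

lemma memLp_two_log_errorLaw (θ : ℝ) : MemLp Real.log 2 (errorLaw θ) := by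
  rw [errorLaw, memLp_map_measure_iff Real.measurable_log.aestronglyMeasurable
    (measurable_rpow_inv θ).aemeasurable]
  refine MemLp.ae_eq (log_rpow_ae_eq θ).symm (MemLp.const_mul ?_ _)
  have hm : AEStronglyMeasurable (fun u : ℝ => Real.log u)
      ((volume : Measure ℝ).restrict (Set.Icc 0 1)) := Real.measurable_log.aestronglyMeasurable
  rw [memLp_two_iff_integrable_sq hm]
  have hint : Integrable (fun u : ℝ => 16 * u ^ (-(1 / 2) : ℝ))
      ((volume : Measure ℝ).restrict (Set.Icc 0 1)) := by
    refine Integrable.const_mul ?_ _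
    have := intervalIntegral.intervalIntegrable_rpow' (a := 0) (b := 1)
      (show (-1 : ℝ) < -(1 / 2) by norm_num)
    rw [intervalIntegrable_iff_integrableOn_Icc_of_le zero_le_one] at this
    exact this
  -- The bound `|log u| * u ^ (1 / 4) < 4` on `(0, 1]`, squared, gives the majorant `16 * u ^ (-1 /
  -- 2)`.
  refine Integrable.mono' hint (hm.pow 2) ?_
  filter_upwards [ae_restrict_Icc_pos, ae_restrict_mem measurableSet_Icc] with u hu hu1
  have h1 := Real.abs_log_mul_self_rpow_lt u (1 / 4) hu hu1.2 (by norm_num)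
  have h2 : (Real.log u * u ^ (1 / 4 : ℝ)) ^ 2 ≤ 16 := by
    rw [← sq_abs]
    nlinarith [abs_nonneg (Real.log u * u ^ (1 / 4 : ℝ))]
  have h3 : (u ^ (1 / 4 : ℝ)) ^ 2 = u ^ (1 / 2 : ℝ) := by
    rw [← Real.rpow_natCast, ← Real.rpow_mul hu.le]; norm_num
  rw [mul_pow, h3] at h2
  rw [Real.norm_of_nonneg (sq_nonneg _), Real.rpow_neg hu.le, ← div_eq_mul_inv,
    le_div_iff₀ (by positivity)]
  exact h2

lemma memLp_two_log_eval (θ : ℝ) :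
    MemLp (fun y : ℕ → ℝ => Real.log (y 0)) 2 (errorSeqLaw θ) :=
  (memLp_two_log_errorLaw θ).comp_measurePreserving (measurePreserving_eval θ 0)

lemma variance_log_ne_zero (hθ : 0 < θ) :
    Var[fun y : ℕ → ℝ => Real.log (y 0); errorSeqLaw θ] ≠ 0 := by
  intro h0
  have h1 := ae_eq_integral_of_variance_eq_zero (memLp_two_log_eval θ) h0
  rw [integral_log_eval] at h1
  have h2 : ∀ᵐ u ∂(errorLaw θ), Real.log u = -θ⁻¹ := by
    rw [← (measurePreserving_eval θ 0).map_eq, ae_map_iff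
      (measurePreserving_eval θ 0).measurable.aemeasurable
      (measurableSet_eq_fun Real.measurable_log measurable_const)]
    exact h1
  rw [errorLaw, ae_map_iff (measurable_rpow_inv θ).aemeasurable
    (measurableSet_eq_fun Real.measurable_log measurable_const)] at h2
  have h3 : ∀ᵐ u ∂((volume : Measure ℝ).restrict (Set.Icc 0 1)), u = Real.exp (-1) := by
    filter_upwards [h2, log_rpow_ae_eq θ, ae_restrict_Icc_pos] with u h h' hu
    rw [h'] at h
    rw [← Real.exp_log hu, Real.exp_eq_exp]
    field_simp at h
    exact h
  have h4 : ∀ᵐ u ∂((volume : Measure ℝ).restrict (Set.Icc 0 1)), u ≠ Real.exp (-1) :=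
    ae_restrict_of_ae (Measure.ae_ne volume _)
  obtain ⟨u, h, h'⟩ := (h3.and h4).exists
  exact h' h

/-- The centered random walk is very negative with probability bounded away from zero. -/
lemma exists_le_measure_sum_log_le (hθ : 0 < θ) : ∃ c : ℝ≥0∞, 0 < c ∧ ∀ L : ℝ,
    ∀ᶠ n : ℕ in atTop, c ≤ errorSeqLaw θ
      {y | ∑ i ∈ Finset.range n, Real.log (y i) + n * θ⁻¹ ≤ -L} := by
  set v : NNReal := Var[fun y : ℕ → ℝ => Real.log (y 0); errorSeqLaw θ].toNNReal with hv
  have hv0 : v ≠ 0 := by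
    rw [hv, Ne, Real.toNNReal_eq_zero, not_le]
    exact lt_of_le_of_ne (variance_nonneg _ _) (variance_log_ne_zero hθ).symm
  have hclt := tendstoInDistribution_inv_sqrt_mul_sum_sub (P := errorSeqLaw θ)
    (P' := gaussianReal 0 v) (X := fun i (y : ℕ → ℝ) => Real.log (y i)) (Y := id)
    HasLaw.id (memLp_two_log_eval θ) (iIndepFun_log θ) (identDistrib_log θ)
  have hpos : 0 < gaussianReal 0 v (Set.Iio (-1)) := by
    refine pos_iff_ne_zero.2 fun h0 => ?_
    have := gaussianReal_absolutelyContinuous' 0 hv0 h0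
    simp at this
  -- `c` lies below the Gaussian mass of `(-∞, -1)`. It serves every `L`, because a deviation of
  -- `-√n` is eventually below `-L`.
  obtain ⟨c, hc0, hc⟩ := exists_between hpos
  refine ⟨c, hc0, fun L => ?_⟩
  have hlim := ProbabilityMeasure.le_liminf_measure_open_of_tendsto hclt.tendsto
    (isOpen_Iio (a := (-1 : ℝ)))
  simp only [ProbabilityMeasure.coe_mk, Measure.map_id] at hlim
  have hL : ∀ᶠ n : ℕ in atTop, L ≤ √(n : ℝ) :=
    (Real.tendsto_sqrt_atTop.comp tendsto_natCast_atTop_atTop).eventually_ge_atTop L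
  filter_upwards [eventually_lt_of_lt_liminf (hc.trans_le hlim), hL, eventually_gt_atTop 0]
    with n hn hLn hn0
  refine hn.le.trans ?_
  rw [Measure.map_apply_of_aemeasurable (hclt.forall_aemeasurable n) measurableSet_Iio]
  refine measure_mono fun y hy => ?_
  have hs : 0 < √(n : ℝ) := Real.sqrt_pos.2 (by exact_mod_cast hn0)
  have hy' : (√(n : ℝ))⁻¹ * (∑ i ∈ Finset.range n, Real.log (y i) -
    n * ∫ y, Real.log (y 0) ∂(errorSeqLaw θ)) < -1 := hy
  rw [integral_log_eval, inv_mul_lt_iff₀ hs] at hy'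
  change ∑ i ∈ Finset.range n, Real.log (y i) + n * θ⁻¹ ≤ -L
  linarith

end Fluctuation

/-! ### Zero length up to and including the critical parameter -/

section Critical

variable {θ : ℝ}

/-- The first `n` terms and the shifted sequence are independent. -/
lemma errorSeqLaw_inter_preimage_shift (θ : ℝ) (n : ℕ) {A B : Set (ℕ → ℝ)} (hA : MeasurableSet A)
    (hB : MeasurableSet B) (hdep : ∀ y z : ℕ → ℝ, (∀ i < n, y i = z i) → y ∈ A → z ∈ A) :
    errorSeqLaw θ (A ∩ shift n ⁻¹' B) = errorSeqLaw θ A * errorSeqLaw θ B := by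
  have hmix : MeasurePreserving (mix (Set.Iio n)) ((errorSeqLaw θ).prod (errorSeqLaw θ))
      (errorSeqLaw θ) := measurePreserving_mix (errorLaw θ) _
  have hpre : mix (Set.Iio n) ⁻¹' (A ∩ shift n ⁻¹' B) = A ×ˢ (shift n ⁻¹' B) := by
    ext p
    have h1 : ∀ i < n, mix (Set.Iio n) p i = p.1 i := fun i hi => by simp [mix, hi]
    have h2 : shift n (mix (Set.Iio n) p) = shift n p.2 := by
      funext i
      simp [shift, mix]
    simp only [Set.mem_preimage, Set.mem_inter_iff, Set.mem_prod, h2]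
    exact and_congr_left fun _ => ⟨hdep _ _ h1, hdep _ _ fun i hi => (h1 i hi).symm⟩
  rw [← hmix.measure_preimage (hA.inter (measurable_shift n hB)).nullMeasurableSet, hpre,
    Measure.prod_prod, (measurePreserving_shift θ n).measure_preimage hB.nullMeasurableSet]

/-- The best bound on the length of the digit sums that is given by the cylinder covers. -/
def coverLength (y : ℕ → ℝ) : ℝ := ⨅ n : ℕ, 2 ^ n * tail y n

lemma measurable_coverLength : Measurable coverLength :=
  Measurable.iInf fun n => (measurable_tail n).const_mul _

lemma coverLength_nonneg {y : ℕ → ℝ} (hy : ∀ i, 0 < y i) : 0 ≤ coverLength y :=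
  Real.iInf_nonneg fun n => mul_nonneg (by positivity) (tail_nonneg hy n)

lemma coverLength_le {y : ℕ → ℝ} (hy : ∀ i, 0 < y i) (n : ℕ) :
    coverLength y ≤ 2 ^ n * tail y n :=
  ciInf_le ⟨0, by rintro _ ⟨n, rfl⟩; exact mul_nonneg (by positivity) (tail_nonneg hy n)⟩ n

lemma coverLength_le_mul {y : ℕ → ℝ} (hy : ∀ i, 0 < y i) (n : ℕ) :
    coverLength y ≤ 2 ^ (n + 1) * point y n * coverLength (shift (n + 1) y) := by
  have hM : 0 < 2 ^ (n + 1) * point y n := mul_pos (by positivity) (point_pos hy n)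
  rw [← div_le_iff₀' hM]
  refine le_ciInf fun m => ?_
  rw [div_le_iff₀' hM]
  refine (coverLength_le hy (n + 1 + m)).trans_eq ?_
  rw [tail_add, pow_add]
  ring

/-- Split on whether the centered walk of the first `n + 1` logarithms is at most `-L`. If so, the
scaling factor is at most `exp (-L)`, so the shifted cover length exceeds `t * exp L`. If not, the
shifted cover length is still positive, and it is independent of the walk. -/
lemma measure_coverLength_gt_le (hθ : 0 < θ) (hle : θ * Real.log 2 ≤ 1) {c : ℝ≥0∞} {L : ℝ} {n : ℕ}
    (hc : c ≤ errorSeqLaw θ {y | ∑ i ∈ Finset.range (n + 1), Real.log (y i) +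
      ((n + 1 : ℕ) : ℝ) * θ⁻¹ ≤ -L}) {t : ℝ} (ht : 0 ≤ t) :
    errorSeqLaw θ {y | t < coverLength y} ≤ (1 - c) * errorSeqLaw θ {y | 0 < coverLength y} +
      errorSeqLaw θ {y | t * Real.exp L < coverLength y} := by
  set S : (ℕ → ℝ) → ℝ := fun y => ∑ i ∈ Finset.range (n + 1), Real.log (y i) +
      ((n + 1 : ℕ) : ℝ) * θ⁻¹ with hS
  have hSm : Measurable S := by
    refine Measurable.add_const (Finset.measurable_fun_sum _ fun i _ => ?_) _
    exact Real.measurable_log.comp (measurable_pi_apply i)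
  set A := {y : ℕ → ℝ | S y ≤ -L} with hA
  have hAm : MeasurableSet A := measurableSet_le hSm measurable_const
  have hGm : ∀ u, MeasurableSet {y : ℕ → ℝ | u < coverLength y} := fun u =>
    measurableSet_lt measurable_const measurable_coverLength
  have hM : ∀ y : ℕ → ℝ, (∀ i, 0 < y i) → 2 ^ (n + 1) * point y n ≤ Real.exp (S y) := by
    intro y hy
    -- The only use of `θ * log 2 ≤ 1`: replacing `log 2` by `θ⁻¹` dominates `log (2 ^ (n + 1) *
    -- point y n)` by the centered walk.
    have hlog : Real.log 2 ≤ θ⁻¹ := by rwa [← one_div, le_div_iff₀' hθ]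
    rw [← Real.log_le_iff_le_exp (mul_pos (by positivity) (point_pos hy n)),
      Real.log_mul (by positivity) (point_pos hy n).ne', log_point hy, Real.log_pow]
    have := mul_le_mul_of_nonneg_left hlog (show (0 : ℝ) ≤ ((n + 1 : ℕ) : ℝ) by positivity)
    simp only [hS]
    linarith
  calc errorSeqLaw θ {y | t < coverLength y}
      ≤ errorSeqLaw θ ((Aᶜ ∩ shift (n + 1) ⁻¹' {y | 0 < coverLength y}) ∪
          shift (n + 1) ⁻¹' {y | t * Real.exp L < coverLength y}) := by
        refine measure_mono_ae ?_
        filter_upwards [ae_errorSeqLaw_pos θ] with y hy hyt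
        have hyt' : t < coverLength y := hyt
        have h1 := coverLength_le_mul hy n
        have hG0 : 0 ≤ coverLength (shift (n + 1) y) := coverLength_nonneg fun i => hy _
        by_cases hyA : y ∈ A
        · right
          change t * Real.exp L < coverLength (shift (n + 1) y)
          have h2 : coverLength y ≤ Real.exp (-L) * coverLength (shift (n + 1) y) :=
            h1.trans (mul_le_mul_of_nonneg_right
              ((hM y hy).trans (Real.exp_le_exp.2 hyA)) hG0)
          rw [Real.exp_neg] at h2
          have h3 := hyt'.trans_le h2
          rwa [lt_inv_mul_iff₀ (Real.exp_pos L), mul_comm] at h3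
        · left
          refine ⟨hyA, ?_⟩
          change 0 < coverLength (shift (n + 1) y)
          refine lt_of_le_of_ne hG0 fun h0 => ?_
          rw [← h0, mul_zero] at h1
          linarith
    _ ≤ _ := by
        refine (measure_union_le _ _).trans ?_
        rw [errorSeqLaw_inter_preimage_shift θ (n + 1) hAm.compl (hGm 0),
          (measurePreserving_shift θ (n + 1)).measure_preimage (hGm _).nullMeasurableSet,
          prob_compl_eq_one_sub hAm]
        · gcongr
        · intro y z hyz hy hz
          apply hy
          have : S y = S z := by
            simp only [hS]
            rw [Finset.sum_congr rfl fun i hi => by rw [hyz i (Finset.mem_range.1 hi)]]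
          change S y ≤ -L
          rw [this]
          exact hz

/-- Letting `L → ∞` and then `t → 0` in the renewal inequality gives `p ≤ (1 - c) * p` for the
probability `p` of a positive cover length, so `p = 0`. The constant `c` must not depend on `L`. -/
lemma ae_coverLength_eq_zero (hθ : 0 < θ) (hle : θ * Real.log 2 ≤ 1) :
    ∀ᵐ y ∂(errorSeqLaw θ), coverLength y = 0 := by
  obtain ⟨c, hc0, hc⟩ := exists_le_measure_sum_log_le hθ
  set p := errorSeqLaw θ {y | 0 < coverLength y} with hp
  have hGm : ∀ u, MeasurableSet {y : ℕ → ℝ | u < coverLength y} := fun u =>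
    measurableSet_lt measurable_const measurable_coverLength
  have h1 : ∀ t : ℝ, 0 < t → errorSeqLaw θ {y | t < coverLength y} ≤ (1 - c) * p := by
    intro t ht
    have hlim : Tendsto (fun K : ℕ => errorSeqLaw θ {y | t * Real.exp K < coverLength y}) atTop
        (𝓝 0) := by
      have h := tendsto_measure_iInter_atTop (μ := errorSeqLaw θ)
        (s := fun K : ℕ => {y | t * Real.exp K < coverLength y})
        (fun K => (hGm _).nullMeasurableSet) (fun K K' hK y hy => by
          have hy' : t * Real.exp K' < coverLength y := hy
          refine lt_of_le_of_lt (b := t * Real.exp K') ?_ hy'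
          gcongr) ⟨0, measure_ne_top _ _⟩
      have hempty : ⋂ K : ℕ, {y | t * Real.exp K < coverLength y} = ∅ := by
        refine Set.eq_empty_iff_forall_notMem.2 fun y hy => ?_
        rw [Set.mem_iInter] at hy
        have hexp : Tendsto (fun K : ℕ => t * Real.exp K) atTop atTop :=
          (Real.tendsto_exp_atTop.comp tendsto_natCast_atTop_atTop).const_mul_atTop ht
        obtain ⟨K, hK⟩ := (hexp.eventually_ge_atTop (coverLength y)).exists
        exact absurd (hy K) (not_lt.2 hK)
      rwa [hempty, measure_empty] at h
    have hlim' := hlim.const_add ((1 - c) * p)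
    rw [add_zero] at hlim'
    refine ge_of_tendsto' hlim' fun K => ?_
    obtain ⟨n, hn⟩ := ((tendsto_add_atTop_nat 1).eventually (hc K)).exists
    exact measure_coverLength_gt_le hθ hle hn ht.le
  have h2 : p ≤ (1 - c) * p := by
    have hU : {y | 0 < coverLength y} = ⋃ m : ℕ, {y | 1 / ((m : ℝ) + 1) < coverLength y} := by
      ext y
      simp only [Set.mem_iUnion, Set.mem_ofPred_eq]
      exact ⟨fun h => exists_nat_one_div_lt h, fun ⟨m, hm⟩ => lt_trans (by positivity) hm⟩
    have hmono : Monotone fun m : ℕ => {y | 1 / ((m : ℝ) + 1) < coverLength y} :=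
      fun m m' hm y (hy : 1 / ((m : ℝ) + 1) < coverLength y) =>
        lt_of_le_of_lt (one_div_le_one_div_of_le (by positivity) (by gcongr)) hy
    have hlim := tendsto_measure_iUnion_atTop (μ := errorSeqLaw θ) hmono
    rw [← hU] at hlim
    exact le_of_tendsto' hlim fun m => h1 _ (by positivity)
  have hp0 : p = 0 := by
    by_contra h0
    refine absurd h2 (not_le.2 ?_)
    calc (1 - c) * p < 1 * p :=
          ENNReal.mul_lt_mul_left h0 (measure_ne_top _ _)
            (ENNReal.sub_lt_self ENNReal.one_ne_top one_ne_zero hc0.ne')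
      _ = p := one_mul p
  filter_upwards [measure_eq_zero_iff_ae_notMem.1 hp0, ae_errorSeqLaw_pos θ] with y hy hpos
  exact le_antisymm (not_lt.1 hy) (coverLength_nonneg hpos)

lemma ae_volume_digitSums_eq_zero (hθ : 0 < θ) (hle : θ * Real.log 2 ≤ 1) :
    ∀ᵐ y ∂(errorSeqLaw θ), volume (digitSums y) = 0 := by
  filter_upwards [ae_coverLength_eq_zero hθ hle, ae_isTypical θ] with y hy hty
  refine le_zero_iff.1 (ENNReal.le_of_forall_pos_le_add fun ε hε _ => ?_)
  rw [zero_add]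
  obtain ⟨n, hn⟩ := exists_lt_of_ciInf_lt (show ⨅ n : ℕ, 2 ^ n * tail y n < (ε : ℝ) by
    rw [← coverLength, hy]; exact hε)
  refine (volume_digitSums_le hty.pos (hty.summable hθ) n).trans ?_
  rw [← ENNReal.ofReal_coe_nnreal]
  exact ENNReal.ofReal_le_ofReal hn.le

end Critical

end Arratia

end

theorem proposition1p2 {Ω : Type*} [MeasurableSpace Ω] (P : Measure Ω) [IsProbabilityMeasure P]
    (θ : ℝ) (hθ : 0 < θ) (Y J : ℕ → Ω → ℝ)
    (hYm : ∀ i, Measurable (Y i)) (hJm : ∀ i, Measurable (J i))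
    (hYlaw : ∀ i, P.map (Y i) = Arratia.errorLaw θ)
    (hJlaw : ∀ i, P.map (J i) = Arratia.coinLaw)
    (hYindep : iIndepFun Y P) (hJindep : iIndepFun J P)
    (hYJ : IndepFun (fun ω i => Y i ω) (fun ω i => J i ω) P) :
    -- the random sum converges almost surely
    (∀ᵐ ω ∂P, Summable (fun i => J i ω * Arratia.point (fun j => Y j ω) i)) ∧
    -- the support of the conditional distribution is the set of all sums with digits 0 and 1
    (∀ᵐ y ∂(P.map (fun ω i => Y i ω)),
      (Arratia.condLaw P Y J y).support = Arratia.digitSums y) ∧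
    -- (a)
    (1 / Real.log 2 < θ → ∀ᵐ y ∂(P.map (fun ω i => Y i ω)),
      Arratia.condLaw P Y J y ≪ volume ∧
      (∃ f : ℝ → ℝ, MemLp f 2 volume ∧ Arratia.IsDensity (Arratia.condLaw P Y J y) f) ∧
      0 < volume (Arratia.condLaw P Y J y).support) ∧
    -- (b)
    (2 / Real.log 2 < θ → ∀ᵐ y ∂(P.map (fun ω i => Y i ω)),
      Arratia.condLaw P Y J y ≪ volume ∧
      (∃ f : ℝ → ℝ, Continuous f ∧ Arratia.IsDensity (Arratia.condLaw P Y J y) f) ∧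
      ∃ a b : ℝ, a < b ∧ Set.Icc a b ⊆ (Arratia.condLaw P Y J y).support) ∧
    -- (c)
    (θ ≤ 1 / Real.log 2 → ∀ᵐ y ∂(P.map (fun ω i => Y i ω)),
      volume (Arratia.condLaw P Y J y).support = 0 ∧
      dimH (Arratia.condLaw P Y J y).support = ENNReal.ofReal (θ * Real.log 2) ∧
      Arratia.measureDimH (Arratia.condLaw P Y J y) = ENNReal.ofReal (θ * Real.log 2)) := by
  have hdist := Arratia.map_errors hYm hYlaw hYindep
  have hcond := Arratia.condLaw_ae_eq hYm hJm hYlaw hJlaw hYindep hJindep hYJ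
  have hl2 : 0 < Real.log 2 := Real.log_pos one_lt_two
  have hne : ∀ y, Arratia.partialLaw Set.univ y ≠ 0 := fun y => IsProbabilityMeasure.ne_zero _
  refine ⟨?_, ?_, fun h => ?_, fun h => ?_, fun h => ?_⟩
  · have hY : AEMeasurable (fun ω i => Y i ω) P := (measurable_pi_lambda _ hYm).aemeasurable
    have hJ : AEMeasurable (fun ω i => J i ω) P := (measurable_pi_lambda _ hJm).aemeasurable
    have h1 := Arratia.ae_isTypical θ
    rw [← hdist] at h1
    have h2 := Arratia.ae_coinSeqLaw
    rw [← Arratia.map_coins hJm hJlaw hJindep] at h2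
    filter_upwards [ae_of_ae_map hY h1, ae_of_ae_map hJ h2] with ω hy ha
    exact Arratia.summable_mul_point hy.pos (hy.summable hθ)
      fun i => Arratia.abs_le_one_of_digit (ha i)
  · rw [hdist]
    filter_upwards [hcond, Arratia.ae_isTypical θ] with y hy hty
    rw [hy, Arratia.support_partialLaw_univ hty.pos (hty.summable hθ)]
  · rw [hdist]
    filter_upwards [hcond, Arratia.ae_exists_memLp_two_isDensity hθ h] with y hy hd
    rw [hy]
    exact ⟨hd.1, hd.2, Arratia.volume_support_pos (hne y) hd.1⟩
  · rw [hdist]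
    filter_upwards [hcond, Arratia.ae_exists_continuous_isDensity hθ h] with y hy hd
    rw [hy]
    obtain ⟨hac, f, hf, hfd⟩ := hd
    exact ⟨hac, ⟨f, hf, hfd⟩, Arratia.exists_Icc_subset_support (hne y) hf hfd⟩
  · have hle : θ * Real.log 2 ≤ 1 := (le_div_iff₀ hl2).1 h
    rw [hdist]
    filter_upwards [hcond, Arratia.ae_isTypical θ, Arratia.ae_volume_digitSums_eq_zero hθ hle,
      Arratia.ae_le_measureDimH hθ hle] with y hy hty hvol hdim
    have hsupp := Arratia.support_partialLaw_univ hty.pos (hty.summable hθ)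
    have hup := hty.dimH_digitSums_le hθ
    have hmid := Arratia.measureDimH_le_dimH_support (Arratia.partialLaw Set.univ y)
    rw [hsupp] at hmid
    rw [hy, hsupp]
    exact ⟨hvol, le_antisymm hup (hdim.trans hmid), le_antisymm (hmid.trans hup) hdim⟩
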